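/- **Model.** Let $G$ be a connected undirected graph with $n\ge 2$ nodes and diameter $D$, and let $s$ be a source node that holds $k\ge 1$ messages. In each synchronous round every node either broadcasts one packet to all its neighbours or is silent. A node $v$ receives a packet in a round if and only if $v$ is silent, exactly one neighbour $u$ of $v$ broadcasts, and no fault occurs; otherwise it hears something that it recognises as not being a packet. In the *sender fault* model each broadcasting node fails (transmits noise), and in the *receiver fault* model each listening node with exactly one broadcasting neighbour fails (receives noise), in each round with probability $p\in[0,1)$, independently of everything else. A *coding schedule* fixes for every node $u$ and round $r$ a function that maps everything $u$ has heard before round $r$ (and, if $u=s$, the messages) to silence or to a packet, and for every node a decoding function. It broadcasts the $k$ messages in $T$ rounds with failure probability at most $\delta$ if, for all values of the messages, with probability at least $1-\delta$ every node other than $s$ decodes all $k$ messages correctly from what it heard in the first $T$ rounds. For constants $a,b$ let messages have $a\lceil\log_2(nk)\rceil$ bits and packets $b\lceil\log_2(nk)\rceil$ bits. The *coding throughput* of $(G,s)$ is $\tau^{NC}_{a,b}(G,s)=\limsup_{k\to\infty} k/L_k$, where $L_k$ is the least number of rounds in which some coding schedule broadcasts $k$ messages with failure probability at most $1/k$. **Decay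 with random linear network coding** over a finite field $F$, for messages in $F^l$: a packet is a pair in $F^k\times F^l$, consisting of a coefficient vector and the corresponding linear combination of the messages. A node at distance $d$ from $s$ is active in the rounds $r=0,1,2,\dots$ with $r\equiv d \pmod 3$. In an active round $r$ it broadcasts with probability $2^{-i}$, where $i=(\lfloor r/3\rfloor \bmod \lceil\log_2 n\rceil)+1$, independently of everything else and whether or not it has received anything yet. The packet that it broadcasts is a combination, with fresh independent uniformly random coefficients from $F$, of all packets it has received (the zero packet if there are none); the source combines the $k$ messages (with their unit coefficient vectors). A node decodes by solving the linear system given by the packets that it has received. **Statement.** Fix $p\in[0,1)$ and one of the two fault models. 1. For every finite field $F$ there is a constant $C$ (depending only on $p$, the fault model and $F$; so for $F=\mathbb F_2$ only on $p$ and the fault model) such that for all $G,s,k,l$ as above, all messages in $F^l$ and every $T\ge C\,(D\log n+k\log n+\log^2 n)$, Decay with random linear network coding delivers all $k$ messages to all nodes within $T$ rounds with probability at least $1-\frac1{\max(n,k)}$ over the faults and the random choices of the algorithm. 2. The same holds with packets of $O(\log(nk))$ bits, and every topology has coding throughput $\Omega(1/\log n)$. Precisely, there are constants $C,c>0$ depending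 only on $p$ and the fault model such that for every $a$ there is a $b$ for which, for all $G,s$ as above: * for every $k\ge 1$ there is a coding schedule of at most $C\,(D\log n+k\log n+\log^2 n)$ rounds, with messages of $a\lceil\log_2(nk)\rceil$ bits and packets of $b\lceil\log_2(nk)\rceil$ bits, that broadcasts $k$ messages with failure probability at most $\frac1{\max(n,k)}$; * $\tau^{NC}_{a,b}(G,s)\ge \dfrac{c}{\log n}$. -/

import Mathlib

open MeasureTheory ProbabilityTheory Filter
open scoped ENNReal

universe u

noncomputable section

namespace NoisyRadio

/-- Whether the random faults hit the broadcasting nodes or the listening nodes. -/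
inductive FaultModel
  | sender
  | receiver

/-- A (network) coding schedule for `k` messages. In round `r`, node `u` applies `act u r` to
what it knows: the `k` messages if it is the source (`some m` for the source, `none` for all other
nodes) and the list of everything it heard so far (one entry per past round, latest round first,
`none` for a round without a packet). The result is a packet to broadcast, or `none` for silence.
`decode u` is the rule by which `u` finally computes the messages from what it heard. -/
structure CodingSchedule (V : Type*) (k : ℕ) (Msg Pkt : Type*) where
  act : V → ℕ → Option (Fin k → Msg) → List (Option Pkt) → Option Pkt
  decode : V → List (Option Pkt) → Fin k → Msg

open Classical in
/-- What `v` hears in a round in which every node `u` broadcasts `tx u` (`none`: silent) and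
`fault u` says whether the fault at `u` occurs. The node `v` gets a packet iff it is silent, exactly
one of its neighbours broadcasts, and there is no fault (at that neighbour for sender faults, at `v`
for receiver faults). In all other cases it hears something that is not a packet. -/
def hear {V Pkt : Type*} (G : SimpleGraph V) (fm : FaultModel) (fault : V → Bool)
    (tx : V → Option Pkt) (v : V) : Option Pkt :=
  if h : tx v = none ∧ ∃! u, G.Adj v u ∧ tx u ≠ none then
    match fm with
    | .sender => if fault h.2.choose then none else tx h.2.choose
    | .receiver => if fault v then none else tx h.2.choose
  else none

open Classical in
/-- The list of everything each node heard in the first `r` rounds (latest round first), when the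
source `s` holds the messages `m` and the fault at node `u` in round `r` occurs iff
`fault r u = true`. -/
def history {V : Type*} {k : ℕ} {Msg Pkt : Type*} (G : SimpleGraph V) (s : V) (fm : FaultModel)
    (S : CodingSchedule V k Msg Pkt) (m : Fin k → Msg) (fault : ℕ → V → Bool) :
    ℕ → V → List (Option Pkt)
  | 0, _ => []
  | r + 1, v =>
    hear G fm (fault r)
      (fun u => S.act u r (if u = s then some m else none) (history G s fm S m fault r u)) v
      :: history G s fm S m fault r v

/-- After `T` rounds all nodes have all `k` messages. -/
def Solved {V : Type*} {k : ℕ} {Msg Pkt : Type*} (G : SimpleGraph V) (s : V) (fm : FaultModel)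
    (S : CodingSchedule V k Msg Pkt) (m : Fin k → Msg) (T : ℕ) (fault : ℕ → V → Bool) : Prop :=
  ∀ v, v ≠ s → S.decode v (history G s fm S m fault T v) = m

/-- Extend the faults of the first `T` rounds to all rounds; later rounds do not matter. -/
def extendFaults {V : Type*} {T : ℕ} (ω : Fin T × V → Bool) (r : ℕ) (v : V) : Bool :=
  if h : r < T then ω (⟨r, h⟩, v) else false

/-- The probability that the schedule `S` has not delivered the messages `m` to all nodes after `T`
rounds, when every fault occurs independently with probability `p`. -/
def failProb {V : Type*} [Fintype V] {k : ℕ} {Msg Pkt : Type*} (G : SimpleGraph V) (s : V)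
    (fm : FaultModel) (p : unitInterval) (T : ℕ) (S : CodingSchedule V k Msg Pkt)
    (m : Fin k → Msg) : ℝ≥0∞ :=
  Measure.pi (fun _ : Fin T × V => bernoulliMeasure true false p)
    {ω | ¬ Solved G s fm S m T (extendFaults ω)}

/-! ### Messages and packets of `O(log (n k))` bits, coding throughput -/

/-- Bit strings of length `a * ⌈log₂ (n * k)⌉`. -/
abbrev Word (a n k : ℕ) : Type := Fin (a * Nat.clog 2 (n * k)) → Bool

/-- The least number of rounds of a coding schedule that broadcasts `k` messages of
`a * ⌈log₂ (n * k)⌉` bits with packets of `b * ⌈log₂ (n * k)⌉` bits and failure probability at most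
`1 / k` (`⊤` if there is none). -/
def minLength {V : Type*} [Fintype V] (G : SimpleGraph V) (s : V) (fm : FaultModel)
    (p : unitInterval) (a b k : ℕ) : ℝ≥0∞ :=
  ⨅ (T : ℕ) (_ : ∃ S : CodingSchedule V k (Word a (Fintype.card V) k) (Word b (Fintype.card V) k),
      ∀ m, failProb G s fm p T S m ≤ (k : ℝ≥0∞)⁻¹), (T : ℝ≥0∞)

/-- The coding throughput of the topology `(G, s)`. -/
def codingThroughput {V : Type*} [Fintype V] (G : SimpleGraph V) (s : V) (fm : FaultModel)
    (p : unitInterval) (a b : ℕ) : ℝ≥0∞ :=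
  limsup (fun k : ℕ => (k : ℝ≥0∞) / minLength G s fm p a b k) atTop

/-! ### Decay with random linear network coding -/

/-- An RLNC packet: a vector of `k` coefficients, and the linear combination of the messages (as
vectors of length `l` over `F`) with these coefficients. -/
abbrev RLNCPacket (F : Type*) (k l : ℕ) : Type _ := (Fin k → F) × (Fin l → F)

/-- The random choices of one node in one round: its Decay coin, and uniformly random coefficients
for its linear combination (the first family for the messages, used by the source; the second for
the packets received so far, used by the other nodes). -/
abbrev Coin (F : Type*) (k T : ℕ) : Type _ := Bool × (Fin k → F) × (Fin T → F)

/-- The Decay probability of round `r`. The rounds are interleaved modulo `3`, so round `r` is in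
slot `r / 3`. A phase has `⌈log₂ n⌉` slots, and the probability in its `i`-th slot
(`i = 1, 2, …`) is `2 ^ (-i)`. -/
def decayProb (n r : ℕ) : unitInterval :=
  ⟨(1 / 2 : ℝ) ^ (r / 3 % Nat.clog 2 n + 1), by positivity,
    pow_le_one₀ (by norm_num) (by norm_num)⟩

/-- The law of the random choices of one node in round `r`. -/
def coinLaw (F : Type*) [MeasurableSpace F] (n k T r : ℕ) : Measure (Coin F k T) :=
  (bernoulliMeasure true false (decayProb n r)).prod
    ((uniformOn Set.univ).prod (uniformOn Set.univ))

/-- The packet formed in a round: the combination of the pairs `(e i, m i)` with the first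
coefficients at the source, and of the packets heard so far with the second coefficients at every
other node (the zero packet if nothing was heard). -/
def rlncPacket {F : Type*} [Field F] {k l T : ℕ} (coin : Coin F k T)
    (known : Option (Fin k → Fin l → F)) (heard : List (Option (RLNCPacket F k l))) :
    RLNCPacket F k l :=
  match known with
  | some m => ∑ i, coin.2.1 i • ((Pi.single i 1, m i) : RLNCPacket F k l)
  | none => ∑ j : Fin T, coin.2.2 j • ((heard[(j : ℕ)]?).join).getD 0

open Classical in
/-- The coding schedule produced by Decay with random linear network coding from its random choices,
for `T` rounds. A node at distance `d` from the source takes part in the rounds `r ≡ d (mod 3)`; in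
these it broadcasts, if its Decay coin says so, a random linear combination of all it knows, whether
or not it has received anything yet. Decoding is by solving the linear system given by the received
packets. -/
def decayRLNC {V : Type*} (G : SimpleGraph V) (s : V) {F : Type*} [Field F] {k T : ℕ} (l : ℕ)
    (coins : Fin T × V → Coin F k T) : CodingSchedule V k (Fin l → F) (RLNCPacket F k l) where
  act u r known heard :=
    if h : r < T then
      if r % 3 = G.dist s u % 3 ∧ (coins (⟨r, h⟩, u)).1 = true then
        some (rlncPacket (coins (⟨r, h⟩, u)) known heard)
      else none
    else none
  decode _ heard :=
    Classical.epsilon fun m : Fin k → Fin l → F =>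
      ∀ y, some y ∈ heard → y.2 = ∑ i, y.1 i • m i

/-- The probability, over the faults and the random choices of the algorithm, that Decay with random
linear network coding over `F` has not delivered the messages `m` to all nodes after `T` rounds. -/
def decayRLNCFailProb {V : Type*} [Fintype V] (G : SimpleGraph V) (s : V) (fm : FaultModel)
    (p : unitInterval) {F : Type*} [Field F] [MeasurableSpace F] {k l : ℕ} (T : ℕ)
    (m : Fin k → Fin l → F) : ℝ≥0∞ :=
  Measure.pi (fun x : Fin T × V =>
      (bernoulliMeasure true false p).prod (coinLaw F (Fintype.card V) k T x.1))
    {ω | ¬ Solved G s fm (decayRLNC G s l fun x => (ω x).2) m T (extendFaults fun x => (ω x).1)}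

/-- `D log n + k log n + log² n` for a graph with `n` nodes and diameter `D`. -/
def roundBound {V : Type*} [Fintype V] (G : SimpleGraph V) (k : ℕ) : ℝ :=
  G.diam * Real.log (Fintype.card V) + k * Real.log (Fintype.card V)
    + Real.log (Fintype.card V) ^ 2

end NoisyRadio

end

/-!
The analysis tests knowledge against one dual vector at a time. For a nonzero `μ ∈ Fᵏ` call a node
informed if it is the source or has heard a packet with a coefficient vector `c` such that
`μ ⬝ᵥ c ≠ 0`; a node that is informed for every `μ` can decode. A random combination formed by an
informed node is again non-orthogonal to `μ` with probability at least `1 / 2`. In a suitable slot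
of each phase of Decay exactly one parent of a node `v` broadcasts with probability at least
`1 / 8`, each parent being equally likely to be the one. So if `f d N` bounds the probability that
a node at distance `d` is uninformed after `N` phases, then
`f (d + 1) (N + 1) ≤ (1 - ε) f (d + 1) N + ε f d N` with `ε = (1 - p) / 16`, which the function
`2 ^ d * (1 - ε / 2) ^ N` solves. The union bound over all `v` and `μ` costs the factor `n |F|ᵏ`,
which `O(D + k + log n)` phases absorb.

For short packets, the messages are split into generations of `Λ = ⌈log₂ (n k)⌉` messages, and the
generations are pipelined through blocks of `Λ` layers: each block works on a generation for `O(Λ)`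
phases and then passes it on, so that `O(k / Λ + D / Λ + 1)` such periods suffice. The random
choices can be fixed in advance, because being informed does not depend on the messages.
-/

noncomputable section

namespace NoisyRadio

/-! ### Hearing and histories -/

/-- The node whose fault spoils a transmission from `u` to `v`. -/
def FaultModel.culprit {V : Type*} : FaultModel → V → V → V
  | .sender, u, _ => u
  | .receiver, _, v => v

section Hearing

variable {V P Q : Type*} {G : SimpleGraph V} {fm : FaultModel} {fault : V → Bool}
  {tx : V → Option P} {u v : V}

theorem hear_eq_of_unique (hv : tx v = none) (hvu : G.Adj v u) (hu : tx u ≠ none)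
    (huniq : ∀ w, G.Adj v w → tx w ≠ none → w = u) :
    hear G fm fault tx v = if fault (fm.culprit u v) then none else tx u := by
  have h : tx v = none ∧ ∃! u, G.Adj v u ∧ tx u ≠ none :=
    ⟨hv, u, ⟨hvu, hu⟩, fun w hw => huniq w hw.1 hw.2⟩
  have hchoose : h.2.choose = u := huniq _ h.2.choose_spec.1.1 h.2.choose_spec.1.2
  rw [hear, dif_pos h]
  cases fm <;> simp only [FaultModel.culprit, hchoose] <;> congr

theorem hear_eq_none_of_not_existsUnique
    (h : ¬ (tx v = none ∧ ∃! u, G.Adj v u ∧ tx u ≠ none)) : hear G fm fault tx v = none := by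
  rw [hear, dif_neg h]

theorem hear_map (κ : P → Q) :
    hear G fm fault (fun u => (tx u).map κ) v = (hear G fm fault tx v).map κ := by
  by_cases h : tx v = none ∧ ∃! u, G.Adj v u ∧ tx u ≠ none
  · obtain ⟨hv, u, ⟨hvu, hu⟩, huniq⟩ := h
    rw [hear_eq_of_unique hv hvu hu fun w hvw hw => huniq w ⟨hvw, hw⟩,
      hear_eq_of_unique (by simp [hv]) hvu (by simpa using hu) fun w hvw hw =>
        huniq w ⟨hvw, by simpa using hw⟩, apply_ite (Option.map κ), Option.map_none]
  · rw [hear_eq_none_of_not_existsUnique h,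
      hear_eq_none_of_not_existsUnique (by simpa using h), Option.map_none]

theorem exists_of_hear_eq_some {y : P} (h : hear G fm fault tx v = some y) :
    ∃ u, tx u = some y := by
  by_cases hv : tx v = none ∧ ∃! u, G.Adj v u ∧ tx u ≠ none
  · obtain ⟨hv, u, ⟨hvu, hu⟩, huniq⟩ := hv
    rw [hear_eq_of_unique hv hvu hu fun w hvw hw => huniq w ⟨hvw, hw⟩] at h
    split_ifs at h
    exact ⟨u, h⟩
  · simp [hear_eq_none_of_not_existsUnique hv] at h

end Hearing

section History

variable {V : Type*} {k k' : ℕ} {Msg Msg' P P' : Type*} {G : SimpleGraph V} {s : V}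
  {fm : FaultModel} {S S' : CodingSchedule V k Msg P} {m : Fin k → Msg}
  {fault fault' : ℕ → V → Bool}

theorem length_history (r : ℕ) (v : V) : (history G s fm S m fault r v).length = r := by
  induction r with
  | zero => rfl
  | succ r ih => rw [history, List.length_cons, ih]

theorem history_congr {r : ℕ} (hS : ∀ r' < r, ∀ u, S.act u r' = S'.act u r')
    (hfault : ∀ r' < r, fault r' = fault' r') :
    history G s fm S m fault r = history G s fm S' m fault' r := by
  induction r with
  | zero => rfl
  | succ r ih =>
    funext v
    simp only [history, hS r r.lt_succ_self, hfault r r.lt_succ_self,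
      ih (fun r' hr' => hS r' (hr'.trans r.lt_succ_self))
        (fun r' hr' => hfault r' (hr'.trans r.lt_succ_self))]

open Classical in
theorem history_map {S' : CodingSchedule V k' Msg' P'} {m' : Fin k' → Msg'} (κ : P → P')
    (h : ∀ u r heard, (S.act u r (if u = s then some m else none) heard).map κ =
      S'.act u r (if u = s then some m' else none) (heard.map (Option.map κ))) (r : ℕ) (v : V) :
    (history G s fm S m fault r v).map (Option.map κ) = history G s fm S' m' fault r v := by
  induction r generalizing v with
  | zero => rfl
  | succ r ih => simp only [history, List.map_cons, ← ih, ← h, hear_map]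

open Classical in
theorem forall_mem_history {p : P → Prop}
    (h : ∀ u r heard, (∀ y, some y ∈ heard → p y) →
      ∀ y, S.act u r (if u = s then some m else none) heard = some y → p y) (r : ℕ) (v : V) :
    ∀ y, some y ∈ history G s fm S m fault r v → p y := by
  induction r generalizing v with
  | zero => simp [history]
  | succ r ih =>
    intro y hy
    rw [history, List.mem_cons] at hy
    rcases hy with hy | hy
    · obtain ⟨u, hu⟩ := exists_of_hear_eq_some hy.symm
      exact h u r _ (ih u) y hu
    · exact ih v y hy

end History

/-! ### Layers of the graph -/

section Layers

variable {V : Type*} {G : SimpleGraph V} (s : V)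

theorem exists_adj_dist_add_one_eq (hG : G.Connected) {v : V} (hv : v ≠ s) :
    ∃ u, G.Adj v u ∧ G.dist s v = G.dist s u + 1 := by
  obtain ⟨walk, hwalk⟩ := hG.exists_walk_length_eq_dist v s
  cases walk with
  | nil => exact absurd rfl hv
  | @cons _ u _ hvu tail =>
    refine ⟨u, hvu, ?_⟩
    have htail : G.dist s u ≤ tail.length := G.dist_comm (u := s) ▸ SimpleGraph.dist_le tail
    have hadj := hvu.diff_dist_adj (u := s)
    rw [SimpleGraph.Walk.length_cons, G.dist_comm] at hwalk
    omega

theorem dist_le_diam [Finite V] (hG : G.Connected) (v : V) : G.dist s v ≤ G.diam :=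
  haveI := hG.nonempty
  SimpleGraph.dist_le_diam (SimpleGraph.connected_iff_ediam_ne_top.1 hG)

theorem diam_lt_card [Fintype V] (hG : G.Connected) : G.diam < Fintype.card V := by
  have := hG.nonempty
  obtain ⟨u, v, huv⟩ := G.exists_dist_eq_diam
  obtain ⟨path, hpath, hlength⟩ := hG.exists_path_of_dist u v
  exact huv ▸ hlength ▸ hpath.length_lt

open Classical in
/-- The neighbours of `v` that are one step closer to `s` than `v`. -/
def parents [Fintype V] (G : SimpleGraph V) (s v : V) : Finset V :=
  {u | G.Adj v u ∧ G.dist s v = G.dist s u + 1}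

variable {s}

theorem mem_parents [Fintype V] {u v : V} :
    u ∈ parents G s v ↔ G.Adj v u ∧ G.dist s v = G.dist s u + 1 := by
  simp [parents]

theorem parents_nonempty [Fintype V] (hG : G.Connected) {v : V} (hv : v ≠ s) :
    (parents G s v).Nonempty :=
  let ⟨u, hu⟩ := exists_adj_dist_add_one_eq s hG hv
  ⟨u, mem_parents.2 hu⟩

theorem card_parents_lt [Fintype V] (v : V) : (parents G s v).card < Fintype.card V :=
  Finset.card_lt_univ_of_notMem (x := v) fun hv => (mem_parents.1 hv).1.ne rfl

end Layers

/-! ### The Decay process -/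

/-- The outcomes of all random choices in `T` rounds: for every round and node whether the fault
occurs, the Decay coin, and a further random choice in `X`, used to form the packet. -/
abbrev Outcome (V X : Type*) (T : ℕ) : Type _ := Fin T × V → Bool × Bool × X

/-- The schedule in which the nodes broadcast in the rounds that Decay prescribes, where `rule` says
how the packets are formed. -/
def decaySchedule {V : Type*} (G : SimpleGraph V) (s : V) {k T : ℕ} {Msg P X : Type*}
    (rule : V → ℕ → Bool × X → Option (Fin k → Msg) → List (Option P) → P)
    (decode : V → List (Option P) → Fin k → Msg) (coins : Fin T × V → Bool × X) :
    CodingSchedule V k Msg P where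
  act u r known heard :=
    open Classical in
    if h : r < T then
      if r % 3 = G.dist s u % 3 ∧ (coins (⟨r, h⟩, u)).1 = true then
        some (rule u r (coins (⟨r, h⟩, u)) known heard)
      else none
    else none
  decode := decode

section Run

variable {V Msg P X : Type*} {k T : ℕ} {G : SimpleGraph V} {s : V} {fm : FaultModel}
  {rule : V → ℕ → Bool × X → Option (Fin k → Msg) → List (Option P) → P}
  {decode : V → List (Option P) → Fin k → Msg} {m : Fin k → Msg}

/-- What each node hears in the first `r` rounds of `decaySchedule`, for given random choices. -/
def run (G : SimpleGraph V) (s : V) (fm : FaultModel)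
    (rule : V → ℕ → Bool × X → Option (Fin k → Msg) → List (Option P) → P)
    (decode : V → List (Option P) → Fin k → Msg) (m : Fin k → Msg) (ω : Outcome V X T) :
    ℕ → V → List (Option P) :=
  history G s fm (decaySchedule G s rule decode fun x => (ω x).2) m (extendFaults fun x => (ω x).1)

theorem length_run (ω : Outcome V X T) (r : ℕ) (v : V) :
    (run G s fm rule decode m ω r v).length = r :=
  length_history r v

theorem run_subset_run_succ (ω : Outcome V X T) (r : ℕ) (v : V) :
    run G s fm rule decode m ω r v ⊆ run G s fm rule decode m ω (r + 1) v :=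
  List.subset_cons_self _ _

theorem dependsOn_run (r : ℕ) :
    DependsOn (fun ω : Outcome V X T => run G s fm rule decode m ω r) {x | (x.1 : ℕ) < r} := by
  intro ω ω' h
  refine history_congr (fun r' hr' u => ?_) fun r' hr' => ?_
  · funext known heard
    by_cases hT : r' < T
    · simp only [decaySchedule, hT, h (⟨r', hT⟩, u) hr']
    · simp only [decaySchedule, hT, dif_neg, not_false_eq_true]
  · funext u
    by_cases hT : r' < T
    · simp only [extendFaults, hT, h (⟨r', hT⟩, u) hr']
    · simp only [extendFaults, hT, dif_neg, not_false_eq_true]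

/-- In round `r` the fault-free packet of `u` is the only one that reaches `v` from the previous
layer. The other neighbours of `v` are silent, since their layers are not active. -/
structure Delivers [Fintype V] (G : SimpleGraph V) (s : V) (fm : FaultModel) (ω : Outcome V X T)
    (r : Fin T) (u v : V) : Prop where
  mem_parents : u ∈ parents G s v
  active : r % 3 = G.dist s u % 3
  broadcasts_iff : ∀ w ∈ parents G s v, (ω (r, w)).2.1 = true ↔ w = u
  no_fault : (ω (r, fm.culprit u v)).1 = false

theorem Delivers.eq [Fintype V] {ω : Outcome V X T} {r : Fin T} {u u' v : V}
    (h : Delivers G s fm ω r u v) (h' : Delivers G s fm ω r u' v) : u = u' :=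
  (h'.broadcasts_iff u h.mem_parents).1 ((h.broadcasts_iff u h.mem_parents).2 rfl)

open Classical in
theorem run_succ_of_delivers [Fintype V] {ω : Outcome V X T} {r : Fin T} {u v : V}
    (h : Delivers G s fm ω r u v) :
    run G s fm rule decode m ω (r + 1) v =
      some (rule u r (ω (r, u)).2 (if u = s then some m else none)
        (run G s fm rule decode m ω r u)) :: run G s fm rule decode m ω r v := by
  obtain ⟨hvu, hdist⟩ := mem_parents.1 h.mem_parents
  have hactive := h.active
  have hu : (ω (r, u)).2.1 = true := (h.broadcasts_iff u h.mem_parents).2 rfl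
  have hv : ¬ (r : ℕ) % 3 = G.dist s v % 3 := by omega
  rw [run, history, ← run, hear_eq_of_unique _ hvu]
  · rw [if_neg (by simp [extendFaults, h.no_fault])]
    simp [decaySchedule, hactive, hu]
  · simp [decaySchedule, hactive, hu]
  · intro w hvw hw
    simp only [decaySchedule, Fin.is_lt, dif_pos, ne_eq, ite_eq_right_iff, reduceCtorEq, imp_false,
      not_not] at hw
    have hadj := hvw.diff_dist_adj (u := s)
    exact (h.broadcasts_iff w (mem_parents.2 ⟨hvw, by omega⟩)).1 hw.2
  · simp [decaySchedule, hv]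

end Run

/-! ### Product measures and uniform coefficients -/

theorem mul_measure_le_prod {α β : Type*} [MeasurableSpace α] [MeasurableSpace β] {μ : Measure α}
    {ν : Measure β} [SFinite μ] [SFinite ν] {A : Set β} {E : Set (α × β)} {c : ℝ≥0∞}
    (hA : MeasurableSet A) (hE : MeasurableSet E) (hc : ∀ y ∈ A, c ≤ μ ((·, y) ⁻¹' E)) :
    c * ν A ≤ μ.prod ν E := by
  calc c * ν A = ∫⁻ _ in A, c ∂ν := (setLIntegral_const A c).symm
    _ ≤ ∫⁻ y in A, μ ((·, y) ⁻¹' E) ∂ν := setLIntegral_mono' hA hc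
    _ ≤ ∫⁻ y, μ ((·, y) ⁻¹' E) ∂ν := setLIntegral_le_lintegral _ _
    _ = μ.prod ν E := (Measure.prod_apply_symm hE).symm

section Pi

variable {ι : Type*} [Fintype ι] {Ω : ι → Type*} [∀ i, MeasurableSpace (Ω i)]
  [∀ i, Countable (Ω i)] [∀ i, MeasurableSingletonClass (Ω i)] {μ : ∀ i, Measure (Ω i)}
  [∀ i, IsProbabilityMeasure (μ i)] {s : Finset ι} {A : Set (∀ i, Ω i)}
  {S : (∀ i, Ω i) → ∀ i, Set (Ω i)}

theorem mul_pi_le_pi_box {c : ℝ≥0∞} (hA : DependsOn (· ∈ A) (s : Set ι)ᶜ)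
    (hS : DependsOn S (s : Set ι)ᶜ) (hc : ∀ ω ∈ A, c ≤ ∏ i ∈ s, μ i (S ω i)) :
    c * Measure.pi μ A ≤ Measure.pi μ {ω ∈ A | ∀ i ∈ s, ω i ∈ S ω i} := by
  classical
  let _ : Fintype s := Subtype.fintype (· ∈ s)
  let e := MeasurableEquiv.piEquivPiSubtypeProd Ω (· ∈ s)
  have he : MeasurePreserving e.symm _ _ :=
    (measurePreserving_piEquivPiSubtypeProd μ (· ∈ s)).symm e
  have he_mem (x y) (i : s) : e.symm (x, y) i = x i := dif_pos i.2
  have he_notMem (x y) (i : {i // i ∉ s}) : e.symm (x, y) i = y i := dif_neg i.2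
  have hagree (x x' y) : ∀ i ∈ (s : Set ι)ᶜ, e.symm (x, y) i = e.symm (x', y) i :=
    fun i hi => (he_notMem x y ⟨i, hi⟩).trans (he_notMem x' y ⟨i, hi⟩).symm
  let A' : Set (∀ i : {i // i ∉ s}, Ω i) := {y | ∃ x, e.symm (x, y) ∈ A}
  calc c * Measure.pi μ A
      ≤ c * Measure.pi (fun i : {i // i ∉ s} => μ i) A' := by
        gcongr
        rw [← he.measure_preimage_equiv, ← one_mul (Measure.pi _ A'),
          ← measure_univ (μ := Measure.pi fun i : s => μ i), ← Measure.prod_prod]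
        exact measure_mono fun z hz => ⟨trivial, z.1, hz⟩
    _ ≤ _ := by
        rw [← he.measure_preimage_equiv]
        refine mul_measure_le_prod .of_discrete .of_discrete fun y ⟨x, hx⟩ => ?_
        refine (hc _ hx).trans ?_
        rw [Finset.prod_subtype s fun _ => Iff.rfl, ← Measure.pi_pi]
        refine measure_mono fun x' hx' => ⟨(hA (hagree x x' y)).mp hx, fun i hi => ?_⟩
        rw [← hS (hagree x x' y), he_mem x' y ⟨i, hi⟩]
        exact hx' ⟨i, hi⟩ trivial

theorem mul_pi_real_le_pi_real_box {c : ℝ} (hA : DependsOn (· ∈ A) (s : Set ι)ᶜ)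
    (hS : DependsOn S (s : Set ι)ᶜ) (hc : ∀ ω ∈ A, c ≤ ∏ i ∈ s, (μ i).real (S ω i)) :
    c * (Measure.pi μ).real A ≤ (Measure.pi μ).real {ω ∈ A | ∀ i ∈ s, ω i ∈ S ω i} := by
  have h := ENNReal.toReal_mono (measure_ne_top _ _)
    (mul_pi_le_pi_box (c := ENNReal.ofReal c) hA hS fun ω hω =>
      ENNReal.ofReal_le_of_le_toReal ((hc ω hω).trans_eq (ENNReal.toReal_prod ..).symm))
  rw [ENNReal.toReal_mul] at h
  refine (mul_le_mul_of_nonneg_right ?_ measureReal_nonneg).trans h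
  exact ENNReal.toReal_ofReal'.symm ▸ le_max_left c 0

end Pi

theorem half_le_measureReal_compl_addSubgroup {A : Type*} [AddGroup A] [MeasurableSpace A]
    [MeasurableAdd A] {μ : Measure A} [IsProbabilityMeasure μ] [μ.IsAddLeftInvariant]
    {H : AddSubgroup A} (hmeas : MeasurableSet (H : Set A)) (hH : H ≠ ⊤) :
    1 / 2 ≤ μ.real (H : Set A)ᶜ := by
  obtain ⟨w, hw⟩ : ∃ w, w ∉ H := by simpa [AddSubgroup.eq_top_iff'] using hH
  have hle : μ.real (H : Set A) ≤ μ.real (H : Set A)ᶜ := by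
    rw [measureReal_def μ (H : Set A)ᶜ, ← measure_preimage_add μ w]
    exact measureReal_mono fun x hx => by simpa [H.add_mem_cancel_right hx] using hw
  linarith [probReal_add_probReal_compl (μ := μ) hmeas]

/-- The law of the random coefficients of one node in one round: the coefficients of the messages,
used by the source, and the coefficients of the packets heard so far, used by the other nodes. -/
def coeffLaw (F : Type*) [MeasurableSpace F] (g T : ℕ) : Measure ((Fin g → F) × (Fin T → F)) :=
  (uniformOn Set.univ).prod (uniformOn Set.univ)

section CoeffLaw

variable {F : Type*} [Finite F] [MeasurableSpace F] [MeasurableSingletonClass F] {g T : ℕ}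

instance [Nonempty F] : IsProbabilityMeasure (coeffLaw F g T) := by
  have (n : ℕ) : IsProbabilityMeasure (uniformOn (Set.univ : Set (Fin n → F))) :=
    isProbabilityMeasure_uniformOn Set.finite_univ Set.univ_nonempty
  exact Measure.prod.instIsProbabilityMeasure _ _

instance [AddGroup F] : (coeffLaw F g T).IsAddLeftInvariant := by
  have (n : ℕ) : (uniformOn (Set.univ : Set (Fin n → F))).IsAddLeftInvariant := by
    rw [uniformOn, ProbabilityTheory.cond, Measure.restrict_univ]
    infer_instance
  exact Measure.prod.instIsAddLeftInvariant

theorem half_le_coeffLaw_ne_zero [Field F] {φ : (Fin g → F) × (Fin T → F) →ₗ[F] F} (hφ : φ ≠ 0) :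
    1 / 2 ≤ (coeffLaw F g T).real {z | φ z ≠ 0} := by
  refine half_le_measureReal_compl_addSubgroup (H := φ.ker.toAddSubgroup) .of_discrete fun h =>
    hφ (LinearMap.ext fun z => ?_)
  exact (h ▸ AddSubgroup.mem_top z : z ∈ φ.ker.toAddSubgroup)

end CoeffLaw

/-! ### One round of Decay -/

theorem one_fourth_le_one_sub_pow {h m : ℕ} (hh : 1 ≤ h) (hm : m ≤ h * 2) :
    1 / 4 ≤ (1 - 1 / (2 * h) : ℝ) ^ m := by
  have hh' : (1 : ℝ) ≤ h := by exact_mod_cast hh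
  have hq : 1 / (2 * h : ℝ) ≤ 1 / 2 := one_div_le_one_div_of_le two_pos (by linarith)
  have hq0 : 0 ≤ 1 / (2 * h : ℝ) := by positivity
  have bernoulli : 1 / 2 ≤ (1 - 1 / (2 * h) : ℝ) ^ h := by
    have := one_add_mul_le_pow (a := -(1 / (2 * h : ℝ))) (by linarith) h
    rw [← sub_eq_add_neg] at this
    refine le_trans (le_of_eq ?_) this
    field_simp
    norm_num
  calc (1 : ℝ) / 4 = (1 / 2) ^ 2 := by norm_num
    _ ≤ ((1 - 1 / (2 * h)) ^ h) ^ 2 := by gcongr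
    _ = (1 - 1 / (2 * h)) ^ (h * 2) := (pow_mul _ _ _).symm
    _ ≤ (1 - 1 / (2 * h)) ^ m := pow_le_pow_of_le_one (by linarith) (by linarith) hm

theorem one_eighth_le_mul_pow {m : ℕ} (hm : m ≠ 0) :
    1 / 8 ≤ (m : ℝ) *
      ((1 / 2) ^ (Nat.log 2 m + 1) * (1 - (1 / 2) ^ (Nat.log 2 m + 1)) ^ (m - 1)) := by
  set h : ℕ := 2 ^ Nat.log 2 m with hh
  have h_le : h ≤ m := Nat.pow_log_le_self 2 hm
  have lt_h : m < h * 2 := Nat.lt_pow_succ_log_self one_lt_two m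
  have hq : (1 / 2 : ℝ) ^ (Nat.log 2 m + 1) = 1 / (2 * h) := by
    rw [hh, one_div_pow, pow_succ', Nat.cast_pow, Nat.cast_ofNat]
  have hh1 : 1 ≤ h := Nat.one_le_two_pow
  have h_half : 1 / 2 ≤ m * (1 / (2 * h : ℝ)) := by
    rw [mul_one_div, div_le_div_iff₀ two_pos (by positivity)]
    have : (h : ℝ) ≤ m := by exact_mod_cast h_le
    linarith
  calc (1 / 8 : ℝ) = 1 / 2 * (1 / 4) := by norm_num
    _ ≤ m * (1 / (2 * h)) * (1 - 1 / (2 * h)) ^ (m - 1) := by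
        gcongr
        exact one_fourth_le_one_sub_pow hh1 (by omega)
    _ = _ := by rw [hq, mul_assoc]

section Box

variable {V X : Type*} [Fintype V]

theorem prod_measureReal_imp_eq {α : Type*} [MeasurableSpace α] (μ : Measure α)
    [IsProbabilityMeasure μ] (u : V) (A : Set α) :
    ∏ w, μ.real {b | w = u → b ∈ A} = μ.real A := by
  rw [Finset.prod_eq_single u (fun w _ hw => by simp [hw]) (by simp)]
  simp

theorem prod_bernoulliMeasure_real_iff_eq (q : unitInterval) {N : Finset V} {u : V} (hu : u ∈ N) :
    ∏ w, (bernoulliMeasure true false q).real {b | w ∈ N → (b = true ↔ w = u)} =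
      q * (1 - q) ^ (N.card - 1) := by
  classical
  have hne : ∀ w ∈ N.erase u,
      (bernoulliMeasure true false q).real {b | w ∈ N → (b = true ↔ w = u)} = 1 - q := by
    intro w hw
    obtain ⟨hwu, hwN⟩ := Finset.mem_erase.1 hw
    simp [hwu, hwN]
  rw [← Finset.prod_subset N.subset_univ (fun w _ hw => by simp [hw]),
    ← Finset.mul_prod_erase N _ hu, Finset.prod_congr rfl hne, Finset.prod_const,
    Finset.card_erase_of_mem hu]
  simp [hu]

/-- The outcomes of one round at node `w` that are needed for `u` to be the only node of `N` that
broadcasts, for its further random choice to be in `A`, and for no fault to spoil the transmission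
from `u` to `v`. -/
def deliveryBox (fm : FaultModel) (N : Finset V) (u v : V) (A : Set X) (w : V) :
    Set (Bool × Bool × X) :=
  {b | w = fm.culprit u v → b ∈ ({false} : Set Bool)} ×ˢ
    ({b | w ∈ N → (b = true ↔ w = u)} ×ˢ {x | w = u → x ∈ A})

theorem le_prod_deliveryBox [MeasurableSpace X] {ν : Measure X} [IsProbabilityMeasure ν]
    (p : unitInterval) (fm : FaultModel) {N : Finset V} {u : V} (hu : u ∈ N) (v : V) {A : Set X}
    (hA : 1 / 2 ≤ ν.real A) {n r : ℕ} (hr : r / 3 % Nat.clog 2 n = Nat.log 2 N.card) :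
    (1 - (p : ℝ)) / 16 / N.card ≤
      ∏ w, ((bernoulliMeasure true false p).prod
        ((bernoulliMeasure true false (decayProb n r)).prod ν)).real
          (deliveryBox fm N u v A w) := by
  simp only [deliveryBox, measureReal_prod_prod, Finset.prod_mul_distrib, prod_measureReal_imp_eq,
    prod_bernoulliMeasure_real_iff_eq _ hu]
  have hN : N.card ≠ 0 := (Finset.card_pos.2 ⟨u, hu⟩).ne'
  have hdecay := one_eighth_le_mul_pow hN
  have hq : (decayProb n r : ℝ) = (1 / 2) ^ (Nat.log 2 N.card + 1) := by simp [decayProb, hr]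
  have hp : 0 ≤ 1 - (p : ℝ) := sub_nonneg.2 p.2.2
  have hN' : (0 : ℝ) < N.card := by positivity
  have hq1 : (1 / 2 : ℝ) ^ (Nat.log 2 N.card + 1) ≤ 1 := pow_le_one₀ (by norm_num) (by norm_num)
  rw [bernoulliMeasure_real_apply_of_notMem_of_mem _ (.singleton _) (by simp) (by simp), hq,
    div_div, div_eq_mul_inv]
  refine mul_le_mul_of_nonneg_left ?_ hp
  calc (16 * (N.card : ℝ))⁻¹ = 1 / 8 / N.card * (1 / 2) := by field_simp; norm_num
    _ ≤ _ := by
        gcongr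
        rwa [div_le_iff₀ hN', mul_comm]

end Box

/-! ### Spreading of information -/

/-- The law of all random choices: faults with probability `p`, the coins of Decay, and further
choices with law `ν`, all independent. -/
def outcomeLaw (V : Type*) [Fintype V] {X : Type*} [MeasurableSpace X] (p : unitInterval)
    (ν : Measure X) (T : ℕ) : Measure (Outcome V X T) :=
  Measure.pi fun x => (bernoulliMeasure true false p).prod
    ((bernoulliMeasure true false (decayProb (Fintype.card V) x.1)).prod ν)

instance {V : Type*} [Fintype V] {X : Type*} [MeasurableSpace X] {p : unitInterval} {ν : Measure X}
    [IsProbabilityMeasure ν] {T : ℕ} : IsProbabilityMeasure (outcomeLaw V p ν T) :=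
  Measure.pi.instIsProbabilityMeasure _

/-- The number of rounds of a phase of Decay: `⌈log₂ n⌉` slots of three interleaved rounds. -/
def phaseLength (n : ℕ) : ℕ := 3 * Nat.clog 2 n

theorem exists_decay_round {n j : ℕ} (hj : j < Nat.clog 2 n) (N d : ℕ) :
    ∃ r, phaseLength n * N ≤ r ∧ r < phaseLength n * (N + 1) ∧ r % 3 = d % 3 ∧
      r / 3 % Nat.clog 2 n = j := by
  have hd : d % 3 < 3 := Nat.mod_lt _ three_pos
  have hdiv : (3 * (Nat.clog 2 n * N + j) + d % 3) / 3 = Nat.clog 2 n * N + j := by omega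
  refine ⟨3 * (Nat.clog 2 n * N + j) + d % 3, ?_, ?_, by omega, ?_⟩
  · rw [phaseLength, mul_assoc]
    omega
  · rw [phaseLength, mul_assoc, mul_add_one]
    omega
  · rw [hdiv, Nat.mul_add_mod, Nat.mod_eq_of_lt hj]

/-- `K r v` is the event that node `v` is informed before round `r`. In a round `r` with
`serves d r`, an informed node of layer `d` informs every node to which it delivers a packet,
provided that its further random choice is in the set `good`, which has probability at least
`1 / 2`. -/
structure Spreads {V X : Type*} [Fintype V] [MeasurableSpace X] {T : ℕ} (G : SimpleGraph V) (s : V)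
    (fm : FaultModel) (ν : Measure X) (serves : ℕ → ℕ → Prop) (K : ℕ → V → Set (Outcome V X T))
    (good : ℕ → V → Outcome V X T → Set X) : Prop where
  source : ∀ r, K r s = Set.univ
  mono : ∀ r v, K r v ⊆ K (r + 1) v
  past : ∀ r v, DependsOn (· ∈ K r v) {x | (x.1 : ℕ) < r}
  good_past : ∀ r u, DependsOn (good r u) {x | (x.1 : ℕ) < r}
  half_le_good : ∀ (r : Fin T) u, ∀ ω ∈ K r u, 1 / 2 ≤ ν.real (good r u ω)
  inform : ∀ (r : Fin T) u v ω, serves (G.dist s u) r → Delivers G s fm ω r u v → ω ∈ K r u →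
    (ω (r, u)).2.2 ∈ good r u ω → ω ∈ K (r + 1) v

/-- The factor by which one phase of Decay decreases the bound `2 ^ x * stallFactor p ^ N` on the
probability that a node `x` layers away has not been informed within `N` phases. -/
def stallFactor (p : unitInterval) : ℝ := 1 - (1 - p) / 32

theorem stallFactor_pos (p : unitInterval) : 0 < stallFactor p := by
  rw [stallFactor]
  linarith [p.2.1]

theorem stallFactor_lt_one {p : unitInterval} (hp : p < 1) : stallFactor p < 1 := by
  have : (p : ℝ) < 1 := hp
  rw [stallFactor]
  linarith

namespace Spreads

variable {V X : Type*} [Fintype V] [MeasurableSpace X]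
  {T : ℕ} {G : SimpleGraph V} {s : V} {fm : FaultModel} {ν : Measure X}
  {serves : ℕ → ℕ → Prop} {K : ℕ → V → Set (Outcome V X T)}
  {good : ℕ → V → Outcome V X T → Set X} {p : unitInterval}

theorem mono_le (h : Spreads G s fm ν serves K good) {r r' : ℕ} (hr : r ≤ r') (v : V) :
    K r v ⊆ K r' v :=
  monotone_nat_of_le_succ (f := fun r => K r v) (fun r => h.mono r v) hr

variable [IsProbabilityMeasure ν]

theorem prob_antitone (h : Spreads G s fm ν serves K good) {r r' : ℕ} (hr : r ≤ r') (v : V) :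
    (outcomeLaw V p ν T).real (K r' v)ᶜ ≤ (outcomeLaw V p ν T).real (K r v)ᶜ :=
  measureReal_mono (Set.compl_subset_compl.2 (h.mono_le hr v))

variable [Countable X] [MeasurableSingletonClass X]

theorem mul_prob_le_prob_delivers (h : Spreads G s fm ν serves K good) {r : Fin T} {u v : V}
    (hu : u ∈ parents G s v) (hactive : r % 3 = G.dist s u % 3)
    (hslot : r / 3 % Nat.clog 2 (Fintype.card V) = Nat.log 2 (parents G s v).card) :
    (1 - (p : ℝ)) / 16 / (parents G s v).card * (outcomeLaw V p ν T).real (K r u \ K r v) ≤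
      (outcomeLaw V p ν T).real {ω ∈ K r u \ K r v |
        Delivers G s fm ω r u v ∧ (ω (r, u)).2.2 ∈ good r u ω} := by
  classical
  have hpast : {x : Fin T × V | (x.1 : ℕ) < r} ⊆
      (({r} ×ˢ .univ : Finset (Fin T × V)) : Set _)ᶜ := by
    rintro ⟨r', w⟩ (hr' : r' < r)
    simpa using hr'.ne'
  refine (mul_pi_real_le_pi_real_box (s := {r} ×ˢ .univ)
    (S := fun ω x => deliveryBox fm (parents G s v) u v (good r u ω) x.2) ?_ ?_ ?_).trans ?_
  · intro ω ω' hω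
    simp only [Set.mem_sdiff, h.past r u fun x hx => hω x (hpast hx),
      h.past r v fun x hx => hω x (hpast hx)]
  · intro ω ω' hω
    simp only [h.good_past r u fun x hx => hω x (hpast hx)]
  · intro ω hω
    have hround := le_prod_deliveryBox p fm hu v (h.half_le_good r u ω hω.1) hslot
    simpa only [Finset.prod_product, Finset.prod_singleton] using hround
  · refine measureReal_mono fun ω ⟨hω, hbox⟩ => ⟨hω, ?_⟩
    have hbox (w : V) := hbox (r, w) (by simp)
    exact ⟨⟨hu, hactive, fun w hw => (hbox w).2.1 hw, (hbox _).1 rfl⟩, (hbox u).2.2 rfl⟩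

theorem sum_prob_delivers_le (h : Spreads G s fm ν serves K good) {r : Fin T} {v : V}
    (hserves : ∀ u ∈ parents G s v, serves (G.dist s u) r) :
    ∑ u ∈ parents G s v, (outcomeLaw V p ν T).real {ω ∈ K r u \ K r v |
        Delivers G s fm ω r u v ∧ (ω (r, u)).2.2 ∈ good r u ω} ≤
      (outcomeLaw V p ν T).real (K r v)ᶜ - (outcomeLaw V p ν T).real (K (r + 1) v)ᶜ := by
  have disjoint : Set.PairwiseDisjoint (parents G s v : Set V) fun u => {ω ∈ K r u \ K r v |
      Delivers G s fm ω r u v ∧ (ω (r, u)).2.2 ∈ good r u ω} := fun u _ u' _ hne =>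
    Set.disjoint_left.2 fun ω hω hω' => hne (hω.2.1.eq hω'.2.1)
  rw [← measureReal_biUnion_finset disjoint fun _ _ => MeasurableSet.of_discrete,
    le_sub_iff_add_le, ← measureReal_union _ .of_discrete (measure_ne_top _ _) (measure_ne_top _ _)]
  · exact measureReal_mono (Set.union_subset (Set.iUnion₂_subset fun u _ ω hω => hω.1.2)
      (Set.compl_subset_compl.2 (h.mono r v)))
  · rw [Set.disjoint_compl_right_iff_subset]
    exact Set.iUnion₂_subset fun u hu ω hω =>
      h.inform r u v ω (hserves u hu) hω.2.1 hω.1.1 hω.2.2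

theorem prob_step (h : Spreads G s fm ν serves K good) (hG : G.Connected) {r : Fin T} {v : V}
    {d : ℕ} (hv : G.dist s v = d + 1) (hserves : serves d r) (hactive : r % 3 = d % 3)
    (hslot : r / 3 % Nat.clog 2 (Fintype.card V) = Nat.log 2 (parents G s v).card) {Y : ℝ}
    (hY : ∀ u, G.dist s u = d → (outcomeLaw V p ν T).real (K r u)ᶜ ≤ Y) :
    (outcomeLaw V p ν T).real (K (r + 1) v)ᶜ ≤
      (1 - (1 - (p : ℝ)) / 16) * (outcomeLaw V p ν T).real (K r v)ᶜ + (1 - (p : ℝ)) / 16 * Y := by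
  set P := outcomeLaw V p ν T
  have hp : 0 ≤ 1 - (p : ℝ) := sub_nonneg.2 p.2.2
  have dist_eq : ∀ u ∈ parents G s v, G.dist s u = d := fun u hu => by
    have := (mem_parents.1 hu).2
    omega
  have hcard : ((parents G s v).card : ℝ) ≠ 0 := by
    have hne : v ≠ s := by
      rintro rfl
      simp at hv
    exact_mod_cast (parents_nonempty hG hne).card_pos.ne'
  have delivers : ∀ u ∈ parents G s v,
      (1 - (p : ℝ)) / 16 / (parents G s v).card * (P.real (K r v)ᶜ - Y) ≤
        P.real {ω ∈ K r u \ K r v | Delivers G s fm ω r u v ∧ (ω (r, u)).2.2 ∈ good r u ω} := by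
    intro u hu
    refine (mul_le_mul_of_nonneg_left ?_ (by positivity)).trans
      (h.mul_prob_le_prob_delivers hu (by rw [dist_eq u hu, hactive]) hslot)
    have split : P.real (K r v)ᶜ ≤ P.real (K r u \ K r v) + P.real (K r u)ᶜ :=
      (measureReal_mono fun ω hω => (em (ω ∈ K r u)).imp (⟨·, hω⟩) id).trans
        (measureReal_union_le _ _)
    linarith [hY u (dist_eq u hu)]
  have total := (Finset.sum_le_sum delivers).trans
    (h.sum_prob_delivers_le fun u hu => (dist_eq u hu).symm ▸ hserves)
  rw [Finset.sum_const, nsmul_eq_mul, ← mul_assoc, mul_div_cancel₀ _ hcard] at total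
  linarith

theorem prob_phase (h : Spreads G s fm ν serves K good) (hG : G.Connected) {N d : ℕ} {v : V}
    (hT : phaseLength (Fintype.card V) * (N + 1) ≤ T) (hv : G.dist s v = d + 1)
    (hserves : ∀ r, phaseLength (Fintype.card V) * N ≤ r →
      r < phaseLength (Fintype.card V) * (N + 1) → serves d r) {Y Z : ℝ}
    (hY : ∀ u, G.dist s u = d →
      (outcomeLaw V p ν T).real (K (phaseLength (Fintype.card V) * N) u)ᶜ ≤ Y)
    (hZ : (outcomeLaw V p ν T).real (K (phaseLength (Fintype.card V) * N) v)ᶜ ≤ Z) :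
    (outcomeLaw V p ν T).real (K (phaseLength (Fintype.card V) * (N + 1)) v)ᶜ ≤
      (1 - (1 - (p : ℝ)) / 16) * Z + (1 - (p : ℝ)) / 16 * Y := by
  have hlog : Nat.log 2 (parents G s v).card < Nat.clog 2 (Fintype.card V) := by
    have hne : v ≠ s := by
      rintro rfl
      simp at hv
    exact (Nat.lt_clog_iff_pow_lt one_lt_two).2
      ((Nat.pow_log_le_self 2 (parents_nonempty hG hne).card_pos.ne').trans_lt (card_parents_lt v))
  obtain ⟨r, hNr, hrN, hactive, hslot⟩ := exists_decay_round hlog N d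
  have step := h.prob_step hG (r := ⟨r, by omega⟩) (p := p) hv (hserves r hNr hrN) hactive hslot
    fun u hu => (h.prob_antitone hNr u).trans (hY u hu)
  have hp : 0 ≤ 1 - (1 - (p : ℝ)) / 16 := by linarith [p.2.1]
  refine (h.prob_antitone hrN v).trans (step.trans ?_)
  gcongr
  exact (h.prob_antitone hNr v).trans hZ

theorem prob_block (h : Spreads G s fm ν serves K good) (hG : G.Connected) {q B d₀ H : ℕ} {Y : ℝ}
    (hT : phaseLength (Fintype.card V) * (q + B) ≤ T)
    (hserves : ∀ d r, d₀ ≤ d → d < d₀ + H → phaseLength (Fintype.card V) * q ≤ r →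
      r < phaseLength (Fintype.card V) * (q + B) → serves d r)
    (hY : ∀ u, G.dist s u = d₀ →
      (outcomeLaw V p ν T).real (K (phaseLength (Fintype.card V) * q) u)ᶜ ≤ Y) (hY0 : 0 ≤ Y)
    {N : ℕ} (hN : N ≤ B) {x : ℕ} (hx : x ≤ H) {v : V} (hv : G.dist s v = d₀ + x) :
    (outcomeLaw V p ν T).real (K (phaseLength (Fintype.card V) * (q + N)) v)ᶜ ≤
      Y + 2 ^ x * stallFactor p ^ N := by
  have hρ := stallFactor_pos p
  induction N generalizing x v with
  | zero =>
    have hpow : (1 : ℝ) ≤ 2 ^ x := one_le_pow₀ one_le_two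
    have hprob := measureReal_le_one (μ := outcomeLaw V p ν T)
      (s := (K (phaseLength (Fintype.card V) * (q + 0)) v)ᶜ)
    rw [pow_zero, mul_one]
    linarith
  | succ N ih =>
    rcases x with _ | x
    · have hle := (h.prob_antitone (Nat.mul_le_mul_left _ (Nat.le_add_right q (N + 1))) v).trans
        (hY v hv)
      have hpos : 0 ≤ (2 : ℝ) ^ 0 * stallFactor p ^ (N + 1) := by positivity
      linarith
    · have hqN : phaseLength (Fintype.card V) * (q + (N + 1)) ≤
          phaseLength (Fintype.card V) * (q + B) := Nat.mul_le_mul_left _ (by omega)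
      refine (h.prob_phase hG (N := q + N) (d := d₀ + x) (hqN.trans hT) hv
        (fun r hr hr' => hserves _ r (by omega) (by omega)
          ((Nat.mul_le_mul_left _ (Nat.le_add_right q N)).trans hr) (hr'.trans_le hqN))
        (fun u hu => ih (by omega) (x := x) (by omega) hu) (ih (by omega) hx hv)).trans_eq ?_
      rw [stallFactor]
      ring

theorem prob_pipeline (h : Spreads G s fm ν serves K good) (hG : G.Connected) {j B H : ℕ}
    (hserves : ∀ d r, r / (phaseLength (Fintype.card V) * B) = j + d / H → serves d r) {i : ℕ}
    (hT : phaseLength (Fintype.card V) * (B * (j + i)) ≤ T) {v : V} (hv : G.dist s v ≤ i * H) :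
    (outcomeLaw V p ν T).real (K (phaseLength (Fintype.card V) * (B * (j + i))) v)ᶜ ≤
      i * (2 ^ H * stallFactor p ^ B) := by
  have hρ := stallFactor_pos p
  induction i generalizing v with
  | zero =>
    obtain rfl : s = v := hG.dist_eq_zero_iff.1 (by omega)
    simp [h.source]
  | succ i ih =>
    have hstart : phaseLength (Fintype.card V) * (B * (j + i)) ≤ T :=
      (Nat.mul_le_mul_left _ (Nat.mul_le_mul_left _ (by omega))).trans hT
    rcases le_total (G.dist s v) (i * H) with hvi | hvi
    · refine ((h.prob_antitone (Nat.mul_le_mul_left _ (Nat.mul_le_mul_left _ (by omega))) v).trans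
        (ih hstart hvi)).trans ?_
      gcongr
      omega
    · obtain ⟨x, hx⟩ := Nat.exists_eq_add_of_le hvi
      rw [add_one_mul] at hv
      have hend : B * (j + (i + 1)) = B * (j + i) + B := by ring
      rw [hend] at hT ⊢
      have block := h.prob_block hG hT (H := H) (p := p) (fun d r hd hdH hr hrB => hserves d r ?_)
        (fun u hu => ih hstart hu.le) (by positivity) le_rfl (by omega) hx
      · refine block.trans ?_
        rw [Nat.cast_add_one, add_one_mul]
        gcongr
        · exact one_le_two
        · omega
      · rw [Nat.div_eq_of_lt_le hd (by rwa [Nat.succ_mul])]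
        refine Nat.div_eq_of_lt_le ?_ ?_
        · rwa [mul_comm, mul_assoc]
        · exact hrB.trans_eq (by ring)

end Spreads

/-! ### Coefficient vectors -/

section Recode

variable {F α β J : Type*} [Field F] {g l T : ℕ}

/-- The coefficient vector of a packet formed by random linear network coding, as a linear function
of the random coefficients; `known` tells the source from the other nodes. -/
def recode (known : Option α) (heard : List (Option (Fin g → F))) :
    (Fin g → F) × (Fin T → F) →ₗ[F] (Fin g → F) :=
  match known with
  | some _ => LinearMap.fst F _ _
  | none =>
    (Fintype.linearCombination F fun t : Fin T => (heard[(t : ℕ)]?).join.getD 0) ∘ₗ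
      LinearMap.snd F _ _

theorem recode_map (f : α → β) (known : Option α) (heard : List (Option (Fin g → F))) :
    (recode (known.map f) heard : (Fin g → F) × (Fin T → F) →ₗ[F] _) = recode known heard := by
  cases known <;> rfl

theorem rlncPacket_fst (coin : Coin F g T) (known : Option (Fin g → Fin l → F))
    (heard : List (Option (RLNCPacket F g l))) :
    (rlncPacket coin known heard).1 = recode known (heard.map (Option.map Prod.fst)) coin.2 := by
  cases known with
  | some m =>
    simp only [rlncPacket, recode, Prod.fst_sum, Prod.smul_fst, LinearMap.fst_apply]
    exact (pi_eq_sum_univ' _).symm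
  | none =>
    simp only [rlncPacket, recode, Prod.fst_sum, Prod.smul_fst, LinearMap.comp_apply,
      LinearMap.snd_apply, Fintype.linearCombination_apply, List.getElem?_map]
    refine Finset.sum_congr rfl fun t _ => ?_
    rcases heard[(t : ℕ)]? with _ | _ | y <;> rfl

theorem exists_recode_some_eq (a : α) (heard : List (Option (Fin g → F))) (c : Fin g → F) :
    ∃ z : (Fin g → F) × (Fin T → F), recode (some a) heard z = c :=
  ⟨(c, 0), rfl⟩

theorem exists_recode_none_eq {heard : List (Option (Fin g → F))} (hT : heard.length ≤ T)
    {c : Fin g → F} (hc : some c ∈ heard) :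
    ∃ z : (Fin g → F) × (Fin T → F), recode (none : Option α) heard z = c := by
  obtain ⟨t, ht, hct⟩ := List.mem_iff_getElem.1 hc
  refine ⟨(0, Pi.single ⟨t, ht.trans_le hT⟩ 1), ?_⟩
  simp [recode, Fintype.linearCombination_apply_single, List.getElem?_eq_getElem ht, hct]

open Classical in
/-- The packets of generation `j` among the packets heard; all others count as not heard. -/
def ofGeneration (j : J) (heard : List (Option (J × α))) : List (Option α) :=
  heard.map fun o => o.bind fun y => if y.1 = j then some y.2 else none

theorem some_mem_ofGeneration {j : J} {heard : List (Option (J × α))} {x : α} :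
    some x ∈ ofGeneration j heard ↔ some (j, x) ∈ heard := by
  constructor
  · intro h
    obtain ⟨o, ho, hx⟩ := List.mem_map.1 h
    obtain ⟨⟨j', y⟩, rfl, hy⟩ := Option.bind_eq_some_iff.1 hx
    obtain ⟨rfl, rfl⟩ : j' = j ∧ y = x := by simpa using hy
    exact ho
  · intro h
    exact List.mem_map.2 ⟨_, h, by simp⟩

theorem ofGeneration_map (f : α → β) (j : J) (heard : List (Option (J × α))) :
    ofGeneration j (heard.map (Option.map (Prod.map id f))) =
      (ofGeneration j heard).map (Option.map f) := by
  simp only [ofGeneration, List.map_map]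
  refine List.map_congr_left fun o _ => ?_
  rcases o with _ | ⟨j', y⟩
  · rfl
  · by_cases hj : j' = j <;> simp [hj]

theorem length_ofGeneration (j : J) (heard : List (Option (J × α))) :
    (ofGeneration j heard).length = heard.length :=
  List.length_map _

end Recode

section Informed

variable {V F J : Type*} [Field F] {g T : ℕ}

/-- The rule that forms only the coefficient vectors of random linear network coding within
generations: a packet is a pair of a generation and a coefficient vector, and layer `d` works on
generation `turn d r` in round `r`. The coefficient vectors do not depend on the messages, so this
rule broadcasts no messages. -/
def coefficientRule (G : SimpleGraph V) (s : V) (turn : ℕ → ℕ → J) (u : V) (r : ℕ)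
    (coin : Coin F g T) (known : Option (Fin 0 → Unit)) (heard : List (Option (J × (Fin g → F)))) :
    J × (Fin g → F) :=
  (turn (G.dist s u) r, recode known (ofGeneration (turn (G.dist s u) r) heard) coin.2)

/-- The generations and coefficient vectors of the packets that each node hears in the first `r`
rounds. -/
def coefficientRun (G : SimpleGraph V) (s : V) (fm : FaultModel) (turn : ℕ → ℕ → J)
    (ω : Outcome V ((Fin g → F) × (Fin T → F)) T) (r : ℕ) (v : V) :
    List (Option (J × (Fin g → F))) :=
  run G s fm (coefficientRule G s turn) (fun _ _ => finZeroElim) finZeroElim ω r v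

/-- The event that before round `r` node `v` is the source or has heard a packet of generation `j`
whose coefficient vector is not orthogonal to `μ`. -/
def informed (G : SimpleGraph V) (s : V) (fm : FaultModel) (turn : ℕ → ℕ → J) (j : J)
    (μ : Fin g → F) (r : ℕ) (v : V) : Set (Outcome V ((Fin g → F) × (Fin T → F)) T) :=
  {ω | v = s ∨ ∃ c, some (j, c) ∈ coefficientRun G s fm turn ω r v ∧ μ ⬝ᵥ c ≠ 0}

open Classical in
/-- The random coefficients with which the packet that `u` forms for generation `j` in round `r` has
a coefficient vector that is not orthogonal to `μ`. -/
def goodCoefficients (G : SimpleGraph V) (s : V) (fm : FaultModel) (turn : ℕ → ℕ → J) (j : J)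
    (μ : Fin g → F) (r : ℕ) (u : V) (ω : Outcome V ((Fin g → F) × (Fin T → F)) T) :
    Set ((Fin g → F) × (Fin T → F)) :=
  {z | μ ⬝ᵥ recode (if u = s then some () else none)
    (ofGeneration j (coefficientRun G s fm turn ω r u)) z ≠ 0}

variable {G : SimpleGraph V} {s : V} {fm : FaultModel} {turn : ℕ → ℕ → J} {j : J} {μ : Fin g → F}

theorem half_le_coeffLaw_goodCoefficients [Finite F] [MeasurableSpace F]
    [MeasurableSingletonClass F] (hμ : μ ≠ 0) (r : Fin T) {u : V}
    {ω : Outcome V ((Fin g → F) × (Fin T → F)) T} (hω : ω ∈ informed G s fm turn j μ r u) :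
    1 / 2 ≤ (coeffLaw F g T).real (goodCoefficients G s fm turn j μ r u ω) := by
  classical
  suffices h : ∃ z, μ ⬝ᵥ recode (if u = s then some () else none)
      (ofGeneration j (coefficientRun G s fm turn ω r u)) z ≠ 0 by
    obtain ⟨z, hz⟩ := h
    exact half_le_coeffLaw_ne_zero (φ := dotProductBilin F F μ ∘ₗ recode _ _)
      fun hφ => hz (LinearMap.congr_fun hφ z)
  by_cases hu : u = s
  · obtain ⟨i, hi⟩ := Function.ne_iff.1 hμ
    obtain ⟨z, hz⟩ := exists_recode_some_eq (T := T) ()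
      (ofGeneration j (coefficientRun G s fm turn ω r u)) (Pi.single i 1)
    exact ⟨z, by simpa [hu ▸ hz, hu] using hi⟩
  · obtain ⟨c, hc, hne⟩ := hω.resolve_left hu
    obtain ⟨z, hz⟩ := exists_recode_none_eq (α := Unit) (T := T)
      (by rw [length_ofGeneration, coefficientRun, length_run]; exact r.2.le)
      (some_mem_ofGeneration.2 hc)
    exact ⟨z, by rwa [if_neg hu, hz]⟩

theorem spreads_informed [Fintype V] [Finite F] [MeasurableSpace F] [MeasurableSingletonClass F]
    (hμ : μ ≠ 0) :
    Spreads G s fm (coeffLaw F g T) (fun d r => turn d r = j) (informed G s fm turn j μ)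
      (goodCoefficients G s fm turn j μ) where
  source r := Set.eq_univ_of_forall fun ω => .inl rfl
  mono r v ω := Or.imp_right fun ⟨c, hc, hne⟩ => ⟨c, run_subset_run_succ ω r v hc, hne⟩
  past r v ω ω' h := by
    simp only [informed, coefficientRun, Set.mem_ofPred_eq, dependsOn_run r h]
  good_past r u ω ω' h := by
    simp only [goodCoefficients, coefficientRun, dependsOn_run r h]
  half_le_good r u ω hω := half_le_coeffLaw_goodCoefficients hμ r hω
  inform r u v ω hturn hdelivers _ hgood := by
    classical
    have hrun : coefficientRun G s fm turn ω (r + 1) v = _ := run_succ_of_delivers hdelivers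
    refine .inr ⟨_, hrun ▸ List.mem_cons.2 (.inl ?_), hgood⟩
    rw [coefficientRule, hturn]
    by_cases hu : u = s <;> simp [hu, recode, coefficientRun]

end Informed

/-! ### Random linear network coding within generations -/

section ValidPackets

variable {F : Type*} [Field F] {g l T : ℕ}

/-- The packets whose second component is the linear combination of the messages `m` that their
coefficient vector claims. -/
def validPackets (m : Fin g → Fin l → F) : Submodule F (RLNCPacket F g l) :=
  (Fintype.linearCombination F m).graph

theorem mem_validPackets {m : Fin g → Fin l → F} {y : RLNCPacket F g l} :
    y ∈ validPackets m ↔ y.2 = ∑ i, y.1 i • m i :=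
  LinearMap.mem_graph_iff ..

theorem rlncPacket_mem_validPackets (coin : Coin F g T) {m : Fin g → Fin l → F}
    {known : Option (Fin g → Fin l → F)} (hknown : ∀ m', known = some m' → m' = m)
    {heard : List (Option (RLNCPacket F g l))}
    (hheard : ∀ y, some y ∈ heard → y ∈ validPackets m) :
    rlncPacket coin known heard ∈ validPackets m := by
  cases known with
  | some m' =>
    obtain rfl := hknown m' rfl
    refine Submodule.sum_mem _ fun i _ => Submodule.smul_mem _ _ (mem_validPackets.2 ?_)
    simp [Pi.single_apply]
  | none =>
    refine Submodule.sum_mem _ fun t _ => Submodule.smul_mem _ _ ?_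
    rcases ht : heard[(t : ℕ)]? with _ | _ | y
    · exact Submodule.zero_mem _
    · exact Submodule.zero_mem _
    · exact hheard y (List.mem_of_getElem? ht)

theorem eq_of_forall_exists_mem_validPackets {M M' : Fin g → Fin l → F}
    (h : ∀ μ : Fin g → F, μ ≠ 0 → ∃ y ∈ validPackets M, y ∈ validPackets M' ∧ μ ⬝ᵥ y.1 ≠ 0) :
    M = M' := by
  by_contra hne
  obtain ⟨i, hi⟩ := Function.ne_iff.1 hne
  obtain ⟨x, hx⟩ := Function.ne_iff.1 hi
  obtain ⟨y, hM, hM', hdot⟩ := h (fun i => M i x - M' i x)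
    (Function.ne_iff.2 ⟨i, sub_ne_zero.2 hx⟩)
  have heq := congrFun ((mem_validPackets.1 hM).symm.trans (mem_validPackets.1 hM')) x
  simp only [Finset.sum_apply, Pi.smul_apply, smul_eq_mul] at heq
  refine hdot ?_
  simp only [dotProduct, mul_comm _ (y.1 _), mul_sub, Finset.sum_sub_distrib, heq, sub_self]

end ValidPackets

section GenerationRule

variable {V Msg P J F : Type*} [Field F] {k g l T : ℕ}

/-- Random linear network coding within generations, where packets of type `P` encode pairs of a
generation and an RLNC packet. The messages of generation `j` are `block m j`, and layer `d` works
on generation `turn d r` in round `r`. -/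
def generationRule (G : SimpleGraph V) (s : V) (e : P ≃ J × RLNCPacket F g l)
    (block : (Fin k → Msg) → J → Fin g → Fin l → F) (turn : ℕ → ℕ → J) (u : V) (r : ℕ)
    (coin : Coin F g T) (known : Option (Fin k → Msg)) (heard : List (Option P)) : P :=
  e.symm (turn (G.dist s u) r, rlncPacket coin (known.map (block · (turn (G.dist s u) r)))
    (ofGeneration (turn (G.dist s u) r) (heard.map (Option.map e))))

/-- The messages `M j` of the generations `j` satisfy the linear equations given by the packets
heard. -/
def Consistent (e : P ≃ J × RLNCPacket F g l) (M : J → Fin g → Fin l → F)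
    (heard : List (Option P)) : Prop :=
  ∀ y, some y ∈ heard → (e y).2 ∈ validPackets (M (e y).1)

variable {G : SimpleGraph V} {s : V} {fm : FaultModel} {e : P ≃ J × RLNCPacket F g l}
  {block : (Fin k → Msg) → J → Fin g → Fin l → F} {turn : ℕ → ℕ → J}
  {decode : V → List (Option P) → Fin k → Msg} {m : Fin k → Msg}

theorem map_run_generationRule (ω : Outcome V ((Fin g → F) × (Fin T → F)) T) (r : ℕ) (v : V) :
    (run G s fm (generationRule G s e block turn) decode m ω r v).map
      (Option.map (Prod.map id Prod.fst ∘ e)) = coefficientRun G s fm turn ω r v := by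
  classical
  refine history_map _ (fun u r' heard => ?_) r v
  have rule_eq (coin : Coin F g T) :
      (Prod.map id Prod.fst ∘ e) (generationRule G s e block turn u r' coin
        (if u = s then some m else none) heard) =
      coefficientRule G s turn u r' coin (if u = s then some finZeroElim else none)
        (heard.map (Option.map (Prod.map id Prod.fst ∘ e))) := by
    rw [generationRule, Function.comp_apply, Equiv.apply_symm_apply, coefficientRule, Prod.map,
      rlncPacket_fst, recode_map, ← ofGeneration_map, List.map_map, Option.map_comp_map]
    by_cases hu : u = s <;> simp only [hu, if_true, if_false, recode, id]
  by_cases hT : r' < T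
  · simp only [decaySchedule, hT, dif_pos, apply_ite (Option.map _), Option.map_some, rule_eq,
      Option.map_none]
  · simp only [decaySchedule, hT, dif_neg, not_false_eq_true, Option.map_none]

theorem consistent_run_generationRule (ω : Outcome V ((Fin g → F) × (Fin T → F)) T) (r : ℕ)
    (v : V) :
    Consistent e (block m) (run G s fm (generationRule G s e block turn) decode m ω r v) := by
  classical
  refine forall_mem_history (fun u r' heard hheard y hy => ?_) r v
  simp only [decaySchedule, Option.dite_none_right_eq_some, Option.ite_none_right_eq_some] at hy
  obtain ⟨_, _, hy⟩ := hy
  obtain rfl := Option.some.inj hy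
  rw [generationRule, Equiv.apply_symm_apply]
  refine rlncPacket_mem_validPackets _ (by simp) fun x hx => ?_
  obtain ⟨o, ho, hox⟩ := List.mem_map.1 (some_mem_ofGeneration.1 hx)
  obtain ⟨y, rfl, hyx⟩ := Option.map_eq_some_iff.1 hox
  simpa only [hyx] using hheard y ho

theorem eq_block_of_informed {ω : Outcome V ((Fin g → F) × (Fin T → F)) T} {r : ℕ} {v : V}
    (hv : v ≠ s) {j : J} (hinf : ∀ μ : Fin g → F, μ ≠ 0 → ω ∈ informed G s fm turn j μ r v)
    {M : J → Fin g → Fin l → F}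
    (hM : Consistent e M (run G s fm (generationRule G s e block turn) decode m ω r v)) :
    M j = block m j := by
  refine eq_of_forall_exists_mem_validPackets fun μ hμ => ?_
  obtain ⟨c, hc, hdot⟩ := (hinf μ hμ).resolve_left hv
  rw [← map_run_generationRule (e := e) (block := block) (decode := decode) (m := m)] at hc
  obtain ⟨o, ho, hoc⟩ := List.mem_map.1 hc
  obtain ⟨y, rfl, hy⟩ := Option.map_eq_some_iff.1 hoc
  obtain ⟨hj, rfl⟩ := Prod.mk.inj hy
  rw [id] at hj
  exact ⟨(e y).2, hj ▸ hM y ho, hj ▸ consistent_run_generationRule ω r v y ho, hdot⟩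

end GenerationRule

section AllInformed

variable {V J F : Type*} [Field F] {g T : ℕ}

/-- The event that after `T` rounds every node can decode all generations in `js`. -/
def allInformed (G : SimpleGraph V) (s : V) (fm : FaultModel) (turn : ℕ → ℕ → J) (js : Finset J) :
    Set (Outcome V ((Fin g → F) × (Fin T → F)) T) :=
  {ω | ∀ v, ∀ j ∈ js, ∀ μ : Fin g → F, μ ≠ 0 → ω ∈ informed G s fm turn j μ T v}

theorem prob_compl_allInformed_le_of_forall [Fintype V] [Fintype F] [MeasurableSpace F]
    [MeasurableSingletonClass F] {p : unitInterval} {G : SimpleGraph V} {s : V} {fm : FaultModel}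
    {turn : ℕ → ℕ → J} {js : Finset J} {Q : ℝ}
    (hQ : 0 ≤ Q) (h : ∀ v, ∀ j ∈ js, ∀ μ : Fin g → F, μ ≠ 0 →
      (outcomeLaw V p (coeffLaw F g T) T).real (informed G s fm turn j μ T v)ᶜ ≤ Q) :
    (outcomeLaw V p (coeffLaw F g T) T).real (allInformed G s fm turn js)ᶜ ≤
      Fintype.card V * js.card * Fintype.card F ^ g * Q := by
  classical
  set I : Finset (V × J × (Fin g → F)) :=
    Finset.univ ×ˢ (js ×ˢ Finset.univ.filter (· ≠ 0))
  have hI : (I.card : ℝ) ≤ Fintype.card V * js.card * Fintype.card F ^ g := by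
    have hμ : (Finset.univ.filter fun μ : Fin g → F => μ ≠ 0).card ≤ Fintype.card F ^ g :=
      (Finset.card_le_univ _).trans_eq (by simp)
    simp only [I, Finset.card_product, Finset.card_univ, mul_assoc]
    exact_mod_cast Nat.mul_le_mul_left _ (Nat.mul_le_mul_left _ hμ)
  have cover : (allInformed (F := F) (g := g) (T := T) G s fm turn js)ᶜ ⊆
      ⋃ x ∈ I, (informed G s fm turn x.2.1 x.2.2 T x.1)ᶜ := by
    intro ω hω
    by_contra hnot
    refine hω fun v j hj μ hμ => by_contra fun hinf => hnot ?_
    exact Set.mem_iUnion₂.2 ⟨(v, j, μ), by simp [I, hj, hμ], hinf⟩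
  calc _ ≤ ∑ x ∈ I, (outcomeLaw V p (coeffLaw F g T) T).real
        (informed G s fm turn x.2.1 x.2.2 T x.1)ᶜ :=
        (measureReal_mono cover (measure_ne_top _ _)).trans (measureReal_biUnion_finset_le _ _)
    _ ≤ I.card • Q := Finset.sum_le_card_nsmul _ _ _ fun x hx => by
        simp only [I, Finset.mem_product, Finset.mem_filter] at hx
        exact h _ _ hx.2.1 _ hx.2.2.2
    _ ≤ _ := by
        rw [nsmul_eq_mul]
        exact mul_le_mul_of_nonneg_right hI hQ

theorem prob_compl_allInformed_le [Fintype V] [Fintype F] [MeasurableSpace F]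
    [MeasurableSingletonClass F] {p : unitInterval} {G : SimpleGraph V} (hG : G.Connected) {s : V}
    {fm : FaultModel} {turn : ℕ → ℕ → J} {js : Finset J} {start : J → ℕ} {B H i : ℕ}
    (hturn : ∀ j ∈ js, ∀ d r, r / (phaseLength (Fintype.card V) * B) = start j + d / H →
      turn d r = j)
    (hT : ∀ j ∈ js, phaseLength (Fintype.card V) * (B * (start j + i)) ≤ T)
    (hdiam : G.diam ≤ i * H) :
    (outcomeLaw V p (coeffLaw F g T) T).real (allInformed G s fm turn js)ᶜ ≤
      Fintype.card V * js.card * Fintype.card F ^ g * (i * (2 ^ H * stallFactor p ^ B)) := by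
  have hρ := stallFactor_pos p
  refine prob_compl_allInformed_le_of_forall (by positivity) fun v j hj μ hμ => ?_
  have hspreads := spreads_informed (G := G) (s := s) (fm := fm) (turn := turn) (j := j) (T := T) hμ
  exact (hspreads.prob_antitone (hT j hj) v).trans
    (hspreads.prob_pipeline hG (hturn j hj) (hT j hj) ((dist_le_diam s hG v).trans hdiam))

end AllInformed

section GenerationSchedule

variable {V Msg P J F : Type*} [Nonempty Msg] [Field F] {k g l T : ℕ}

/-- Decay with random linear network coding within generations. A node decodes by choosing messages
that satisfy the linear equations of all generations. -/
def generationSchedule (G : SimpleGraph V) (s : V) (e : P ≃ J × RLNCPacket F g l)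
    (block : (Fin k → Msg) → J → Fin g → Fin l → F) (turn : ℕ → ℕ → J)
    (coins : Fin T × V → Coin F g T) : CodingSchedule V k Msg P :=
  decaySchedule G s (generationRule G s e block turn)
    (fun _ heard => Classical.epsilon fun m => Consistent e (block m) heard) coins

theorem solved_of_mem_allInformed {G : SimpleGraph V} {s : V} {fm : FaultModel}
    {e : P ≃ J × RLNCPacket F g l} {block : (Fin k → Msg) → J → Fin g → Fin l → F}
    {turn : ℕ → ℕ → J} {js : Finset J} {m : Fin k → Msg}
    (hblock : ∀ m', (∀ j ∈ js, block m' j = block m j) → m' = m)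
    {ω : Outcome V ((Fin g → F) × (Fin T → F)) T} (hω : ω ∈ allInformed G s fm turn js) :
    Solved G s fm (generationSchedule G s e block turn fun x => (ω x).2) m T
      (extendFaults fun x => (ω x).1) :=
  fun v hv => hblock _ fun j hj => eq_block_of_informed hv (hω v j hj) <|
    Classical.epsilon_spec (p := fun m' => Consistent e (block m') _)
      ⟨m, consistent_run_generationRule ω T v⟩

end GenerationSchedule

/-! ### Failure probability of Decay with random linear network coding -/

section PlainDecay

variable {V F : Type*} [Field F]

theorem decayRLNC_eq_generationSchedule (G : SimpleGraph V) (s : V) {k l T : ℕ}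
    (coins : Fin T × V → Coin F k T) :
    decayRLNC G s l coins =
      generationSchedule G s (Equiv.punitProd _).symm (fun m _ => m) (fun _ _ => ())
        coins := by
  have ofGeneration_eq (heard : List (Option (RLNCPacket F k l))) :
      ofGeneration () (heard.map (Option.map (Equiv.punitProd _).symm)) = heard := by
    rw [ofGeneration, List.map_map]
    refine (List.map_congr_left fun o _ => ?_).trans heard.map_id
    cases o <;> simp
  simp only [decayRLNC, generationSchedule, decaySchedule]
  congr 1
  funext u r known heard
  have rule_eq (coin : Coin F k T) :
      generationRule G s (Equiv.punitProd _).symm (fun (m : Fin k → Fin l → F) _ => m)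
        (fun _ _ => ()) u r coin known heard = rlncPacket coin known heard := by
    rw [generationRule, ofGeneration_eq, Option.map_id']
    rfl
  simp only [rule_eq]

theorem decayRLNCFailProb_toReal_le [Fintype V] [Fintype F] [MeasurableSpace F]
    [MeasurableSingletonClass F] {G : SimpleGraph V} (hG : G.Connected) (s : V) (fm : FaultModel)
    (p : unitInterval) {k l T : ℕ} (m : Fin k → Fin l → F) :
    (decayRLNCFailProb G s fm p T m).toReal ≤ Fintype.card V * Fintype.card F ^ k *
      (2 ^ G.diam * stallFactor p ^ (T / phaseLength (Fintype.card V))) := by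
  have subset_compl : {ω : Outcome V ((Fin k → F) × (Fin T → F)) T |
      ¬ Solved G s fm (decayRLNC G s l fun x => (ω x).2) m T (extendFaults fun x => (ω x).1)} ⊆
      (allInformed G s fm (fun _ _ => ()) Finset.univ)ᶜ := by
    refine fun ω hω hinf => hω ?_
    rw [decayRLNC_eq_generationSchedule]
    exact solved_of_mem_allInformed (fun m' h => h () (Finset.mem_univ ())) hinf
  refine (measureReal_mono (μ := outcomeLaw V p (coeffLaw F k T) T) subset_compl).trans ?_
  refine (prob_compl_allInformed_le hG (start := fun _ => 0) (i := 1) (H := G.diam)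
    (B := T / phaseLength (Fintype.card V)) (fun _ _ _ _ _ => rfl) (fun _ _ => ?_)
    (one_mul _).ge).trans_eq (by simp)
  rw [zero_add, mul_one]
  exact Nat.mul_div_le _ _

end PlainDecay

theorem clog_le_three_mul_log {n : ℕ} (hn : 2 ≤ n) : (Nat.clog 2 n : ℝ) ≤ 3 * Real.log n := by
  have hpow : (2 : ℝ) ^ (Nat.clog 2 n - 1) ≤ n := by
    exact_mod_cast (Nat.pow_pred_clog_lt_self one_lt_two hn).le
  have hlog := Real.log_le_log (by positivity) hpow
  rw [Real.log_pow, Nat.cast_sub (Nat.clog_pos one_lt_two hn), Nat.cast_one] at hlog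
  have hlog2 : Real.log 2 ≤ Real.log n := Real.log_le_log two_pos (by exact_mod_cast hn)
  nlinarith [Real.log_two_gt_d9]

theorem log_max_le (n k : ℕ) : Real.log (max n k : ℕ) ≤ Real.log n + k := by
  have hlogn : 0 ≤ Real.log n := Real.log_natCast_nonneg n
  have hlogk : Real.log k ≤ k := Real.log_le_self k.cast_nonneg
  rcases max_cases n k with ⟨h, -⟩ | ⟨h, -⟩ <;> rw [h]
  · exact le_add_of_nonneg_right k.cast_nonneg
  · exact hlogk.trans (le_add_of_nonneg_left hlogn)

theorem le_natCast_inv_of_toReal_le {x : ℝ≥0∞} {N : ℕ} (hx : x ≠ ⊤) (hN : 0 < N)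
    (h : x.toReal ≤ (N : ℝ)⁻¹) : x ≤ (N : ℝ≥0∞)⁻¹ := by
  refine (ENNReal.toReal_le_toReal hx (by simpa using hN.ne')).1 ?_
  rwa [ENNReal.toReal_inv, ENNReal.toReal_natCast]

theorem stallFactor_pow_le_exp (p : unitInterval) (B : ℕ) :
    stallFactor p ^ B ≤ Real.exp (-((1 - (p : ℝ)) / 32 * B)) := by
  rw [mul_comm, ← mul_neg, Real.exp_nat_mul]
  exact pow_le_pow_left₀ (stallFactor_pos p).le (Real.one_sub_le_exp_neg _) _

theorem mul_stallFactor_pow_le_inv_max {p : unitInterval} {n k f D B : ℕ} (hn : 1 ≤ n) (hk : 1 ≤ k)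
    (hf : 1 ≤ f)
    (hB : (Real.log f + 2) * (D + k + Real.log n) ≤ (1 - (p : ℝ)) / 32 * (B + 1)) :
    n * (f : ℝ) ^ k * (2 ^ D * stallFactor p ^ B) ≤ ((max n k : ℕ) : ℝ)⁻¹ := by
  have hn0 : (0 : ℝ) < n := by exact_mod_cast hn
  have hf0 : (0 : ℝ) < f := by exact_mod_cast hf
  have hk1 : (1 : ℝ) ≤ k := by exact_mod_cast hk
  have hmax0 : (0 : ℝ) < (max n k : ℕ) := by exact_mod_cast hn.trans (le_max_left n k)
  have exponent_le : Real.log n + k * Real.log f + (D * Real.log 2 + -((1 - (p : ℝ)) / 32 * B)) ≤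
      -Real.log (max n k : ℕ) := by
    have hmax := log_max_le n k
    have hD : D * Real.log 2 ≤ D :=
      mul_le_of_le_one_right D.cast_nonneg (by linarith [Real.log_two_lt_d9])
    have hq : 0 ≤ Real.log f * (D + Real.log n) := by positivity
    have : (0 : ℝ) ≤ D := D.cast_nonneg
    have hp : (0 : ℝ) ≤ p := p.2.1
    nlinarith
  calc n * (f : ℝ) ^ k * (2 ^ D * stallFactor p ^ B)
      ≤ n * (f : ℝ) ^ k * (2 ^ D * Real.exp (-((1 - (p : ℝ)) / 32 * B))) := by
        gcongr
        exact stallFactor_pow_le_exp p B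
    _ = Real.exp (Real.log n + k * Real.log f + (D * Real.log 2 + -((1 - (p : ℝ)) / 32 * B))) := by
        rw [Real.exp_add, Real.exp_add, Real.exp_add, Real.exp_nat_mul,
          Real.exp_nat_mul, Real.exp_log hn0, Real.exp_log hf0, Real.exp_log two_pos]
    _ ≤ Real.exp (-Real.log (max n k : ℕ)) := Real.exp_le_exp.2 exponent_le
    _ = _ := by rw [Real.exp_neg, Real.exp_log hmax0]

theorem mul_le_div_phaseLength_add_one {n D k T : ℕ} (hn : 2 ≤ n) {A : ℝ}
    (hT : 9 * A * (D * Real.log n + k * Real.log n + Real.log n ^ 2) ≤ T) :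
    A * (D + k + Real.log n) ≤ (T / phaseLength n : ℕ) + 1 := by
  have hlog : 0 < Real.log n := Real.log_pos (by exact_mod_cast hn)
  have hphase : 0 < phaseLength n := Nat.mul_pos three_pos (Nat.clog_pos one_lt_two hn)
  have hphase_le : (phaseLength n : ℝ) ≤ 9 * Real.log n := by
    rw [phaseLength, Nat.cast_mul, Nat.cast_ofNat]
    linarith [clog_le_three_mul_log hn]
  have hT_lt : (T : ℝ) ≤ phaseLength n * ((T / phaseLength n : ℕ) + 1) := by
    exact_mod_cast (Nat.lt_mul_div_succ T hphase).le
  refine le_of_mul_le_mul_left ?_ (show (0 : ℝ) < 9 * Real.log n by positivity)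
  calc 9 * Real.log n * (A * (D + k + Real.log n))
      = 9 * A * (D * Real.log n + k * Real.log n + Real.log n ^ 2) := by ring
    _ ≤ phaseLength n * ((T / phaseLength n : ℕ) + 1) := hT.trans hT_lt
    _ ≤ 9 * Real.log n * ((T / phaseLength n : ℕ) + 1) := by gcongr

theorem exists_forall_decayRLNCFailProb_le (fm : FaultModel) (p : unitInterval) (hp : p < 1)
    (F : Type*) [Field F] [Finite F] [MeasurableSpace F] [MeasurableSingletonClass F] :
    ∃ C : ℝ, 0 < C ∧ ∀ (V : Type u) [Fintype V] (G : SimpleGraph V) (s : V), G.Connected →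
      2 ≤ Fintype.card V → ∀ k l T : ℕ, 1 ≤ k → C * roundBound G k ≤ T →
        ∀ m : Fin k → Fin l → F,
          decayRLNCFailProb G s fm p T m ≤ ((max (Fintype.card V) k : ℕ) : ℝ≥0∞)⁻¹ := by
  have hε : 0 < (1 - (p : ℝ)) / 32 := div_pos (sub_pos.2 (by exact_mod_cast hp)) (by norm_num)
  let _ := Fintype.ofFinite F
  have : 0 ≤ Real.log (Fintype.card F) := Real.log_natCast_nonneg _
  refine ⟨9 * ((Real.log (Fintype.card F) + 2) / ((1 - (p : ℝ)) / 32)), by positivity, ?_⟩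
  intro V _ G s hG hn k l T hk hT m
  have hB := mul_le_div_phaseLength_add_one hn hT
  rw [div_mul_eq_mul_div, div_le_iff₀' hε] at hB
  refine le_natCast_inv_of_toReal_le (measure_ne_top (outcomeLaw V p (coeffLaw F k T) T) _)
    (hk.trans (le_max_right _ _)) ?_
  exact (decayRLNCFailProb_toReal_le hG s fm p m).trans
    (mul_stallFactor_pow_le_inv_max (by omega) hk Fintype.card_pos hB)

/-! ### Coding schedules and throughput -/

theorem exists_coins_le {V X : Type*} [Fintype V] [Countable X] [MeasurableSpace X]
    [MeasurableSingletonClass X] (p : unitInterval) (ν : Measure X) [IsProbabilityMeasure ν] {T : ℕ}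
    (E : Set (Outcome V X T)) :
    ∃ coins : Fin T × V → Bool × X,
      Measure.pi (fun _ : Fin T × V => bernoulliMeasure true false p)
        {ω | (fun x => (ω x, coins x)) ∈ E} ≤ outcomeLaw V p ν T E := by
  have hmp := measurePreserving_arrowProdEquivProdArrow Bool (Bool × X) (Fin T × V)
    (fun _ => bernoulliMeasure true false p)
    (fun x => (bernoulliMeasure true false (decayProb (Fintype.card V) x.1)).prod ν)
  rw [show outcomeLaw V p ν T E = _ from ((hmp.symm _).measure_preimage_equiv E).symm,
    Measure.prod_apply_symm (Set.to_countable _).measurableSet]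
  exact exists_le_lintegral (measurable_of_countable _).aemeasurable

theorem exists_coins_failProb_le {V Msg P J F : Type*} [Fintype V] [Nonempty Msg] [Field F]
    [Finite F] [MeasurableSpace F] [MeasurableSingletonClass F] {k g l : ℕ} (G : SimpleGraph V)
    (s : V) (fm : FaultModel) (p : unitInterval) (e : P ≃ J × RLNCPacket F g l)
    (turn : ℕ → ℕ → J) {block : (Fin k → Msg) → J → Fin g → Fin l → F} {js : Finset J}
    (hblock : ∀ m m', (∀ j ∈ js, block m' j = block m j) → m' = m) (T : ℕ) :
    ∃ coins : Fin T × V → Coin F g T, ∀ m,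
      failProb G s fm p T (generationSchedule G s e block turn coins) m ≤
        outcomeLaw V p (coeffLaw F g T) T (allInformed G s fm turn js)ᶜ := by
  obtain ⟨coins, hcoins⟩ := exists_coins_le p (coeffLaw F g T) (allInformed G s fm turn js)ᶜ
  refine ⟨coins, fun m => (measure_mono fun ω hω => ?_).trans hcoins⟩
  exact fun hinf => hω (solved_of_mem_allInformed (hblock m) hinf)

section Pipeline

/-- Bits as elements of the field with two elements. -/
def bitEquiv : Bool ≃ ZMod 2 := Fintype.equivOfCardEq (by simp [ZMod.card])

/-- Bit strings as packets that consist of the number of a generation, of coefficients for the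
messages of this generation, and of a combination of these messages. -/
def wordEquiv (a n k : ℕ) : Word (a + 2) n k ≃
    Fin (2 ^ Nat.clog 2 (n * k)) ×
      RLNCPacket (ZMod 2) (Nat.clog 2 (n * k)) (a * Nat.clog 2 (n * k)) :=
  Fintype.equivOfCardEq (by
    simp only [Fintype.card_fun, Fintype.card_fin, Fintype.card_bool, Fintype.card_prod, ZMod.card]
    ring)

/-- The messages of generation `j`, filled up with zeros. A generation consists of
`⌈log₂ (n k)⌉` messages, so that its coefficient vectors fit into the packets. -/
def generationMessages {a n k : ℕ} (m : Fin k → Word a n k) (j : Fin (2 ^ Nat.clog 2 (n * k)))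
    (x : Fin (Nat.clog 2 (n * k))) (i : Fin (a * Nat.clog 2 (n * k))) : ZMod 2 :=
  if h : j * Nat.clog 2 (n * k) + x < k then bitEquiv (m ⟨j * Nat.clog 2 (n * k) + x, h⟩ i) else 0

theorem generationMessages_apply {a n k : ℕ} (m : Fin k → Word a n k) (i : Fin k)
    {j : Fin (2 ^ Nat.clog 2 (n * k))} {x : Fin (Nat.clog 2 (n * k))}
    (hi : j * Nat.clog 2 (n * k) + x = i) (b : Fin (a * Nat.clog 2 (n * k))) :
    generationMessages m j x b = bitEquiv (m i b) := by
  rw [generationMessages, dif_pos (hi ▸ i.2)]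
  simp only [hi]

theorem eq_of_generationMessages_eq {a n k : ℕ} (hn : 1 ≤ n) {m m' : Fin k → Word a n k}
    (h : ∀ j : Fin (2 ^ Nat.clog 2 (n * k)), (j : ℕ) ≤ k / Nat.clog 2 (n * k) →
      generationMessages m' j = generationMessages m j) : m' = m := by
  funext i b
  have hΛ : 0 < Nat.clog 2 (n * k) := Nat.pos_of_mul_pos_left (b.pos)
  have hk : k ≤ 2 ^ Nat.clog 2 (n * k) :=
    (Nat.le_mul_of_pos_left _ hn).trans (Nat.le_pow_clog one_lt_two _)
  let j : Fin (2 ^ Nat.clog 2 (n * k)) :=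
    ⟨i / Nat.clog 2 (n * k), (Nat.div_le_self _ _).trans_lt (i.2.trans_le hk)⟩
  let x : Fin (Nat.clog 2 (n * k)) := ⟨i % Nat.clog 2 (n * k), Nat.mod_lt _ hΛ⟩
  have hi : j * Nat.clog 2 (n * k) + x = i := Nat.div_add_mod' _ _
  have heq := congrFun (congrFun (h j (Nat.div_le_div_right i.2.le)) x) b
  rwa [generationMessages_apply m' i hi, generationMessages_apply m i hi,
    bitEquiv.apply_eq_iff_eq] at heq

/-- The generation on which layer `d` works in round `r` when the generations are pipelined through
blocks of `⌈log₂ (n k)⌉` layers, with `B` phases of Decay per block: generation `j` is in block `q`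
during the phases `B (j + q), …, B (j + q + 1) - 1`. The values for earlier and later rounds are
irrelevant. -/
def pipelineTurn (n k B d r : ℕ) : Fin (2 ^ Nat.clog 2 (n * k)) :=
  Fin.ofNat _ (r / (phaseLength n * B) - d / Nat.clog 2 (n * k))

theorem pipelineTurn_eq {n k B d r : ℕ} {j : Fin (2 ^ Nat.clog 2 (n * k))}
    (h : r / (phaseLength n * B) = j + d / Nat.clog 2 (n * k)) : pipelineTurn n k B d r = j := by
  rw [pipelineTurn, h, Nat.add_sub_cancel]
  exact Fin.ext (Nat.mod_eq_of_lt j.2)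

theorem exists_schedule_failProb_le {V : Type*} [Fintype V] {G : SimpleGraph V}
    (hG : G.Connected) (hn : 2 ≤ Fintype.card V) (s : V) (fm : FaultModel) (p : unitInterval)
    (a : ℕ) {k : ℕ} (hk : 1 ≤ k) (B : ℕ) {T : ℕ}
    (hT : phaseLength (Fintype.card V) * (B * (k / Nat.clog 2 (Fintype.card V * k) +
      (G.diam / Nat.clog 2 (Fintype.card V * k) + 1))) ≤ T) :
    ∃ S : CodingSchedule V k (Word a (Fintype.card V) k) (Word (a + 2) (Fintype.card V) k),
      ∀ m, (failProb G s fm p T S m).toReal ≤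
        (2 ^ Nat.clog 2 (Fintype.card V * k)) ^ 5 * stallFactor p ^ B := by
  have hρ := stallFactor_pos p
  set n := Fintype.card V
  set Λ := Nat.clog 2 (n * k)
  have hΛ : 0 < Λ := Nat.clog_pos one_lt_two (hn.trans (Nat.le_mul_of_pos_right _ hk))
  have hnpow : n ≤ 2 ^ Λ := (Nat.le_mul_of_pos_right _ hk).trans (Nat.le_pow_clog one_lt_two _)
  have hblocks : G.diam / Λ + 1 ≤ 2 ^ Λ :=
    (Nat.succ_le_of_lt ((Nat.div_le_self _ _).trans_lt (diam_lt_card hG))).trans hnpow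
  let js : Finset (Fin (2 ^ Λ)) := Finset.univ.filter fun j => (j : ℕ) ≤ k / Λ
  have hjs : js.card ≤ 2 ^ Λ := (Finset.card_le_univ _).trans_eq (Fintype.card_fin _)
  obtain ⟨coins, hcoins⟩ := exists_coins_failProb_le G s fm p (wordEquiv a n k)
    (pipelineTurn n k B) (js := js) (block := generationMessages) (fun m m' h =>
      eq_of_generationMessages_eq (by omega) fun j hj => h j (by simpa [js] using hj)) T
  refine ⟨_, fun m => (ENNReal.toReal_mono (measure_ne_top _ _) (hcoins m)).trans ?_⟩
  refine (prob_compl_allInformed_le hG (start := Fin.val) (fun j _ d r => pipelineTurn_eq)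
    (i := G.diam / Λ + 1) (fun j hj => le_trans ?_ hT) ?_).trans ?_
  · have hj' : (j : ℕ) ≤ k / Λ := by simpa [js] using hj
    exact Nat.mul_le_mul_left _ (Nat.mul_le_mul_left _ (by omega))
  · rw [mul_comm]
    exact (Nat.lt_mul_div_succ _ hΛ).le
  · rw [ZMod.card]
    calc (n : ℝ) * js.card * (2 : ℕ) ^ Λ * ((G.diam / Λ + 1 : ℕ) * (2 ^ Λ * stallFactor p ^ B))
        ≤ (2 ^ Λ : ℕ) * (2 ^ Λ : ℕ) * (2 : ℕ) ^ Λ *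
            ((2 ^ Λ : ℕ) * (2 ^ Λ * stallFactor p ^ B)) := by
          gcongr
      _ = _ := by push_cast; ring

theorem pipelineLength_le {n k D c : ℕ} (hn : 2 ≤ n) :
    ((phaseLength n * (c * Nat.clog 2 (n * k) * (k / Nat.clog 2 (n * k) +
      (D / Nat.clog 2 (n * k) + 1))) : ℕ) : ℝ) ≤
        27 * c * (D * Real.log n + k * Real.log n + Real.log n ^ 2) := by
  set Λ := Nat.clog 2 (n * k)
  have hΛ : Λ ≤ Nat.clog 2 n + k := by
    refine Nat.clog_le_of_le_pow ?_
    rw [pow_add]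
    exact Nat.mul_le_mul (Nat.le_pow_clog one_lt_two _) Nat.lt_two_pow_self.le
  have hsum : Λ * (k / Λ + (D / Λ + 1)) ≤ 2 * k + D + Nat.clog 2 n := by
    have hk := Nat.mul_div_le k Λ
    have hD := Nat.mul_div_le D Λ
    rw [mul_add, mul_add, mul_one]
    omega
  have hclog := clog_le_three_mul_log hn
  have : 0 ≤ Real.log n := Real.log_natCast_nonneg n
  have : (0 : ℝ) ≤ k := k.cast_nonneg
  have : (0 : ℝ) ≤ D := D.cast_nonneg
  calc ((phaseLength n * (c * Λ * (k / Λ + (D / Λ + 1))) : ℕ) : ℝ)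
      ≤ (3 * Nat.clog 2 n * (c * (2 * k + D + Nat.clog 2 n)) : ℕ) := by
        rw [phaseLength, mul_assoc c]
        exact_mod_cast Nat.mul_le_mul_left _ (Nat.mul_le_mul_left _ hsum)
    _ = 3 * Nat.clog 2 n * (c * (2 * k + D + Nat.clog 2 n)) := by push_cast; ring
    _ ≤ 3 * (3 * Real.log n) * (c * (3 * k + 3 * D + 3 * Real.log n)) := by
        gcongr 3 * ?_ * (c * ?_)
        linarith
    _ = _ := by ring

theorem mul_pow_le_inv_max {ρ : ℝ} (hρ : 0 ≤ ρ) {c : ℕ} (hc : ρ ^ c ≤ (1 / 2) ^ 6) {n k : ℕ}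
    (hn : 1 ≤ n) (hk : 1 ≤ k) :
    (2 ^ Nat.clog 2 (n * k)) ^ 5 * ρ ^ (c * Nat.clog 2 (n * k)) ≤ ((max n k : ℕ) : ℝ)⁻¹ := by
  set Λ := Nat.clog 2 (n * k)
  have hmax : max n k ≤ 2 ^ Λ :=
    (max_le (Nat.le_mul_of_pos_right _ hk) (Nat.le_mul_of_pos_left _ hn)).trans
      (Nat.le_pow_clog one_lt_two _)
  have : (0 : ℝ) < (max n k : ℕ) := by exact_mod_cast hn.trans (le_max_left n k)
  calc (2 ^ Λ) ^ 5 * ρ ^ (c * Λ) ≤ (2 ^ Λ) ^ 5 * ((1 / 2) ^ 6) ^ Λ := by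
        rw [pow_mul ρ]
        gcongr
    _ = ((2 ^ Λ : ℕ) : ℝ)⁻¹ := by
        rw [pow_right_comm (1 / 2 : ℝ), one_div, inv_pow, Nat.cast_pow, Nat.cast_ofNat]
        field_simp
    _ ≤ _ := by gcongr

end Pipeline

theorem exists_schedule (fm : FaultModel) (p : unitInterval) (hp : p < 1) :
    ∃ C : ℝ, 0 < C ∧ ∀ a : ℕ, ∀ (V : Type u) [Fintype V] (G : SimpleGraph V) (s : V), G.Connected →
      2 ≤ Fintype.card V → ∀ k : ℕ, 1 ≤ k → ∃ T : ℕ, (T : ℝ) ≤ C * roundBound G k ∧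
        ∃ S : CodingSchedule V k (Word a (Fintype.card V) k) (Word (a + 2) (Fintype.card V) k),
          ∀ m, failProb G s fm p T S m ≤ ((max (Fintype.card V) k : ℕ) : ℝ≥0∞)⁻¹ := by
  obtain ⟨c, hc⟩ := exists_pow_lt_of_lt_one (show (0 : ℝ) < (1 / 2) ^ 6 by positivity)
    (stallFactor_lt_one hp)
  have hc0 : 0 < c := Nat.pos_of_ne_zero (by rintro rfl; norm_num at hc)
  refine ⟨27 * c, by positivity, fun a V _ G s hG hn k hk => ?_⟩
  obtain ⟨S, hS⟩ := exists_schedule_failProb_le hG hn s fm p a hk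
    (c * Nat.clog 2 (Fintype.card V * k)) le_rfl
  refine ⟨_, pipelineLength_le hn, S, fun m => ?_⟩
  exact le_natCast_inv_of_toReal_le (measure_ne_top _ _) (hk.trans (le_max_right _ _))
    ((hS m).trans (mul_pow_le_inv_max (stallFactor_pos p).le hc.le (by omega) hk))

theorem le_codingThroughput {V : Type*} [Fintype V] {G : SimpleGraph V} {s : V} {fm : FaultModel}
    {p : unitInterval} {a b : ℕ} {C : ℝ} (hC : 0 < C) (hn : 2 ≤ Fintype.card V)
    (h : ∀ k : ℕ, 1 ≤ k → ∃ T : ℕ, (T : ℝ) ≤ C * roundBound G k ∧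
      ∃ S : CodingSchedule V k (Word a (Fintype.card V) k) (Word b (Fintype.card V) k),
        ∀ m, failProb G s fm p T S m ≤ ((max (Fintype.card V) k : ℕ) : ℝ≥0∞)⁻¹) :
    ENNReal.ofReal (1 / (2 * C) / Real.log (Fintype.card V)) ≤ codingThroughput G s fm p a b := by
  set n := Fintype.card V
  have hlog : 0 < Real.log n := Real.log_pos (by exact_mod_cast hn)
  refine le_limsup_of_frequently_le (Eventually.frequently ?_)
  filter_upwards [eventually_ge_atTop 1,
    tendsto_natCast_atTop_atTop.eventually_ge_atTop ((G.diam : ℝ) + Real.log n)] with k hk hkD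
  obtain ⟨T, hT, S, hS⟩ := h k hk
  have : (0 : ℝ) < k := by exact_mod_cast hk
  have hmin : minLength G s fm p a b k ≤ T := by
    refine iInf₂_le T ⟨S, fun m => (hS m).trans ?_⟩
    gcongr
    exact le_max_right _ _
  have hround : roundBound G k ≤ 2 * (k * Real.log n) := by
    unfold roundBound
    nlinarith
  have hT_le : (T : ℝ≥0∞) ≤ ENNReal.ofReal (2 * C * (k * Real.log n)) := by
    rw [← ENNReal.ofReal_natCast]
    refine ENNReal.ofReal_le_ofReal (hT.trans ?_)
    linarith [mul_le_mul_of_nonneg_left hround hC.le]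
  calc ENNReal.ofReal (1 / (2 * C) / Real.log n)
      = ENNReal.ofReal (k / (2 * C * (k * Real.log n))) := by
        congr 1
        field_simp
    _ = k / ENNReal.ofReal (2 * C * (k * Real.log n)) := by
        rw [ENNReal.ofReal_div_of_pos (by positivity), ENNReal.ofReal_natCast]
    _ ≤ k / minLength G s fm p a b k := ENNReal.div_le_div_left (hmin.trans hT_le) _

end NoisyRadio

end

theorem mainTheorem10 (fm : NoisyRadio.FaultModel) (p : unitInterval) (hp : p < 1) :
    (∀ (F : Type) [Field F] [Fintype F] [MeasurableSpace F] [MeasurableSingletonClass F],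
      ∃ C : ℝ, 0 < C ∧
        ∀ (V : Type u) [Fintype V] (G : SimpleGraph V) (s : V),
          G.Connected → 2 ≤ Fintype.card V →
          ∀ k l T : ℕ, 1 ≤ k → C * NoisyRadio.roundBound G k ≤ T →
            ∀ m : Fin k → Fin l → F,
              NoisyRadio.decayRLNCFailProb G s fm p T m
                ≤ ((max (Fintype.card V) k : ℕ) : ℝ≥0∞)⁻¹) ∧
    (∃ C c : ℝ, 0 < C ∧ 0 < c ∧ ∀ a : ℕ, ∃ b : ℕ,
        ∀ (V : Type u) [Fintype V] (G : SimpleGraph V) (s : V),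
          G.Connected → 2 ≤ Fintype.card V →
          (∀ k : ℕ, 1 ≤ k →
            ∃ T : ℕ, (T : ℝ) ≤ C * NoisyRadio.roundBound G k ∧
              ∃ S : NoisyRadio.CodingSchedule V k (NoisyRadio.Word a (Fintype.card V) k)
                  (NoisyRadio.Word b (Fintype.card V) k),
                ∀ m, NoisyRadio.failProb G s fm p T S m
                  ≤ ((max (Fintype.card V) k : ℕ) : ℝ≥0∞)⁻¹) ∧
          ENNReal.ofReal (c / Real.log (Fintype.card V))
            ≤ NoisyRadio.codingThroughput G s fm p a b) := by
  refine ⟨fun F => NoisyRadio.exists_forall_decayRLNCFailProb_le fm p hp F, ?_⟩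
  obtain ⟨C, hC, h⟩ := NoisyRadio.exists_schedule.{u} fm p hp
  exact ⟨C, 1 / (2 * C), hC, by positivity, fun a => ⟨a + 2, fun V _ G s hG hn =>
    ⟨h a V G s hG hn, NoisyRadio.le_codingThroughput hC hn (h a V G s hG hn)⟩⟩⟩
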